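/- **Setting.** Let $\mathcal X$ be a measurable space, $\mathcal Y$ a finite label set, $(\Theta,\mathcal T)$ a measurable space, and $(\theta,x)\mapsto f_\theta(x)\in\mathcal Y$ a measurable family of classification rules. Let $\pi$ be a (prior) probability measure on $\Theta$. For each sample size $N\ge 1$ let $(X_i,Y_i)_{i=1}^N$ be independent (not necessarily identically distributed), with joint law $\mathbb P=\mathbb P_N=\bigotimes_{i=1}^N P_i^{(N)}$ on $(\mathcal X\times\mathcal Y)^N$. Put $$R(\theta)=\tfrac1N\sum_{i=1}^N\mathbb P[f_\theta(X_i)\ne Y_i],\quad r(\theta)=\tfrac1N\sum_{i=1}^N\mathbf 1[f_\theta(X_i)\ne Y_i],\quad D(\theta,\theta')=\tfrac1N\sum_{i=1}^N\mathbb P[f_\theta(X_i)\ne f_{\theta'}(X_i)],$$ $$m'(\theta,\theta')=\tfrac1N\sum_{i=1}^N\bigl(\mathbf 1[f_\theta(X_i)\ne Y_i]-\mathbf 1[f_{\theta'}(X_i)\ne Y_i]\bigr)^2 .$$ For bounded measurable $h$ let $\pi_{\exp(-\lambda h)}$ be the probability measure with density $e^{-\lambda h}/\pi[e^{-\lambda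 h}]$ with respect to $\pi$; write $\rho(h)=\int h\,d\rho$ and let $\mathcal K$ denote the Kullback divergence. **The empirical bound.** Let $\Lambda_2=\{2^k: k\in\mathbb N,\ 0\le k<\log N/\log 2\}$, let $\nu$ be the uniform probability measure on $\Lambda_2$, and let $\epsilon\in(0,1)$. Let $F_{\gamma,a}(x)=-N\log[1-\tanh(\gamma/N)x]-ax$, and, for $0\le a<N\tanh(\gamma/N)$, let $F_{\gamma,a}^{-1}:[0,\infty)\to[0,1/\tanh(\gamma/N))$ be its inverse. With $$G_{\gamma,\lambda}(\rho)=\log\Bigl\{\pi_{\exp(-\lambda r)}\bigl[\exp\{N\log[\cosh(\tfrac\gamma N)]\,\rho(m')\}\bigr]\Bigr\},\qquad \ell=-\log[\epsilon\,\nu(\{\beta\})\,\nu(\{\gamma\})],$$ define for $\beta,\gamma\in\Lambda_2$ and a probability measure $\rho$ on $\Theta$ $$B(\rho,\beta,\gamma)=\inf_{\substack{0\le\lambda_1\le\gamma\\ \lambda_2>\frac{\beta\gamma}{N}\tanh(\frac\gamma N)^{-1}}}\Bigl\{\mathcal K[\rho,\pi_{\exp(-\lambda_1 r)}]+(\gamma-\lambda_1)\bigl[\rho(r)-\pi_{\exp(-\lambda_2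 r)}(r)\bigr]+G_{\gamma,\lambda_1}(\rho)+\ell+(\gamma-\lambda_1)\tfrac{\beta}{\lambda_2}F^{-1}_{\gamma,\frac{\beta\gamma}{\lambda_2}}\bigl[G_{\gamma,\lambda_2}(\pi_{\exp(-\lambda_2 r)})+\ell\bigr]\Bigr\}.$$ Let $\widehat\gamma\in\arg\max_{\gamma\in\Lambda_2}\max\{\beta\in\Lambda_2: B(\pi_{\exp(-\gamma r/2)},\beta,\gamma)\le 0\}$ (any choice of maximizer, with $\max\varnothing=-\infty$). This choice depends only on the data, $\pi$, $\epsilon$ and $N$. **Theorem.** There are universal constants $B_7,B_8>0$ such that the following holds. In the setting above, assume that $R$ does not depend on $N$; that for some $\widetilde\theta\in\Theta$, $c>0$ and $\kappa>1$ (none of them depending on $N$) the margin assumption $$R(\theta)-R(\widetilde\theta)\ \ge\ c\,D(\theta,\widetilde\theta)^\kappa,\qquad\theta\in\Theta,$$ holds for every $N\ge1$; and that for some $d>0$ $$\lim_{\beta\to+\infty}\beta\bigl[\pi_{\exp(-\beta R)}(R)-\inf_\Theta R\bigr]=d .$$ Then there is $N_1\in\mathbb N$ such that for all $N\ge N_1$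 and all $\epsilon\in(0,1)$, with $\mathbb P$-probability at least $1-\epsilon$, $$\pi_{\exp(-\widehat\gamma r/2)}(R)\ \le\ \inf_\Theta R+B_7\,c^{-\frac1{2\kappa-1}}\Bigl[1+\frac{B_8}{d}\log\Bigl(\frac{\log N}{\epsilon}\Bigr)\Bigr]^{\frac{2\kappa}{2\kappa-1}}\Bigl(\frac dN\Bigr)^{\frac{\kappa}{2\kappa-1}} .$$ -/

import Mathlib

open MeasureTheory ProbabilityTheory Filter Topology

universe u v w

namespace GibbsMargin

variable {X Y Θ : Type*}

open Classical in
/-- The error indicator `1[f_θ(x) ≠ y]` of the rule `f θ` at a labelled pattern `(x, y)`. -/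
noncomputable def err (f : Θ → X → Y) (θ : Θ) (p : X × Y) : ℝ :=
  if f θ p.1 ≠ p.2 then 1 else 0

/-- The empirical error rate `r(θ)` on the sample `z`. -/
noncomputable def empRisk (f : Θ → X → Y) {N : ℕ} (z : Fin N → X × Y) (θ : Θ) : ℝ :=
  (1 / (N : ℝ)) * ∑ i, err f θ (z i)

/-- The empirical pseudo-distance `m'(θ, θ')` on the sample `z`. -/
noncomputable def empDist (f : Θ → X → Y) {N : ℕ} (z : Fin N → X × Y) (θ θ' : Θ) : ℝ :=
  (1 / (N : ℝ)) * ∑ i, (err f θ (z i) - err f θ' (z i)) ^ 2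

/-- The expected error rate `R(θ) = (1/N) ∑ᵢ P(f_θ(Xᵢ) ≠ Yᵢ)`, where `P i` is the law
of the labelled pattern `(Xᵢ, Yᵢ)`. -/
noncomputable def risk [MeasurableSpace X] [MeasurableSpace Y] (f : Θ → X → Y) {N : ℕ}
    (P : Fin N → Measure (X × Y)) (θ : Θ) : ℝ :=
  (1 / (N : ℝ)) * ∑ i, (P i).real {p | f θ p.1 ≠ p.2}

/-- The pseudo-distance `D(θ, θ') = (1/N) ∑ᵢ P(f_θ(Xᵢ) ≠ f_θ'(Xᵢ))`. -/
noncomputable def disagreement [MeasurableSpace X] [MeasurableSpace Y] (f : Θ → X → Y) {N : ℕ}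
    (P : Fin N → Measure (X × Y)) (θ θ' : Θ) : ℝ :=
  (1 / (N : ℝ)) * ∑ i, (P i).real {p | f θ p.1 ≠ f θ' p.1}

/-- The Gibbs distribution `π_{exp(-l h)}`, with density `exp(-l h) / π[exp(-l h)]`
with respect to `π`. -/
noncomputable def gibbs [MeasurableSpace Θ] (π : Measure Θ) (h : Θ → ℝ) (l : ℝ) : Measure Θ :=
  π.tilted (fun θ => -(l * h θ))

/-- The function `F_{γ,a}(x) = -N log(1 - tanh(γ/N) x) - a x`. -/
noncomputable def devF (N : ℕ) (γ a x : ℝ) : ℝ :=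
  -(N : ℝ) * Real.log (1 - Real.tanh (γ / N) * x) - a * x

/-- The inverse of `F_{γ,a}`. For `γ > 0` and `0 ≤ a < N tanh(γ/N)` (the only case in which it
is used), `F_{γ,a}` is an increasing bijection from `[0, 1 / tanh(γ/N))` onto `[0, ∞)`. -/
noncomputable def devFInv (N : ℕ) (γ a : ℝ) : ℝ → ℝ :=
  Function.invFunOn (devF N γ a) {x | 0 ≤ x ∧ Real.tanh (γ / N) * x < 1}

/-- The quantity `log { π_{exp(-l r)} [ exp { N log[cosh(γ/N)] ρ(m') } ] }`. -/
noncomputable def logMoment [MeasurableSpace Θ] (f : Θ → X → Y) (π : Measure Θ) {N : ℕ}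
    (z : Fin N → X × Y) (γ l : ℝ) (ρ : Measure Θ) : ℝ :=
  Real.log (∫ θ, Real.exp ((N : ℝ) * Real.log (Real.cosh (γ / N)) * ∫ θ', empDist f z θ θ' ∂ρ)
    ∂(gibbs π (empRisk f z) l))

/-- The empirical bound `B(ρ, β, γ)` at confidence level `ε`, for atoms `β, γ` of the
probability measure `ν` on the positive half-line. -/
noncomputable def empBound [MeasurableSpace Θ] (f : Θ → X → Y) (π : Measure Θ) {N : ℕ}
    (z : Fin N → X × Y) (ν : Measure ℝ) (ε : ℝ) (ρ : Measure Θ) (β γ : ℝ) : EReal :=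
  ⨅ (l₁ : ℝ) (_ : 0 ≤ l₁ ∧ l₁ ≤ γ) (l₂ : ℝ) (_ : β * γ / N * (Real.tanh (γ / N))⁻¹ < l₂),
    ((InformationTheory.klDiv ρ (gibbs π (empRisk f z) l₁) : ENNReal) : EReal) +
    (((γ - l₁) * (∫ θ, empRisk f z θ ∂ρ
          - ∫ θ, empRisk f z θ ∂(gibbs π (empRisk f z) l₂))
      + logMoment f π z γ l₁ ρ
      - Real.log (ε * ν.real {β} * ν.real {γ})
      + (γ - l₁) * (β / l₂) * devFInv N γ (β * γ / l₂)
          (logMoment f π z γ l₂ (gibbs π (empRisk f z) l₂)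
            - Real.log (ε * ν.real {β} * ν.real {γ})) : ℝ) : EReal)

/-- The grid `Λ_a = {a ^ k ; k ∈ ℕ, 0 ≤ k < log N / log a}`. -/
noncomputable def grid (a : ℝ) (N : ℕ) : Finset ℝ :=
  (Finset.range ⌈Real.log N / Real.log a⌉₊).image (fun k : ℕ => a ^ k)

open Classical in
/-- `max {β ∈ Λ₂ ; B(π_{exp(-γ r / 2)}, β, γ) ≤ 0}`, where `B` is computed with `ν` uniform
on `Λ₂`; the maximum of the empty set is `⊥` (that is, `-∞`). -/
noncomputable def betaMax [MeasurableSpace Θ] (f : Θ → X → Y) (π : Measure Θ) {N : ℕ}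
    (ε : ℝ) (z : Fin N → X × Y) (γ : ℝ) : WithBot ℝ :=
  ((grid 2 N).filter (fun β => empBound f π z (uniformOn (grid 2 N : Set ℝ)) ε
    (gibbs π (empRisk f z) (γ / 2)) β γ ≤ 0)).max

/-- The set `argmax_{γ ∈ Λ₂} max {β ∈ Λ₂ ; B(π_{exp(-γ r / 2)}, β, γ) ≤ 0}`. -/
def gammaArgmax [MeasurableSpace Θ] (f : Θ → X → Y) (π : Measure Θ) {N : ℕ}
    (ε : ℝ) (z : Fin N → X × Y) : Set ℝ :=
  {γ | γ ∈ grid 2 N ∧ ∀ γ' ∈ grid 2 N, betaMax f π ε z γ' ≤ betaMax f π ε z γ}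

end GibbsMargin

/-! Let `n` be the cardinality of the grid and `L = log (n ^ 2 / ε)`, so that each event of
probability `exp (-L)` costs `ε / n ^ 2`. The proof combines two facts.

Validity. For a pair of temperatures with `β < γ / 2`, an exact exponential inequality for relative
risks, integrated against two copies of the non-random Gibbs measure at `β R`, gives the event
`DevEvent`. On it a convexity argument (`devF_sub_le`) bounds the excess of the posterior mean of
`R` over its mean under `π_{exp(-β R)}` by a complexity term, and `DevEvent.mean_sub_le` removes the
unobservable mean of `r` under that measure. Hence `B ≤ 0` forces the posterior at `γ r / 2` to be
no worse than `π_{exp(-β R)}`, whose excess risk is about `d / β`. Maximizing `β` subject to `B ≤ 0`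
is therefore the right selection rule.

Sharpness. At one well-chosen pair, `B ≤ 0` does hold (`Localized.empBound_nonpos`). Seven random
log-partition functions are bounded above by Markov's inequality. The margin assumption absorbs
their variance into a shift `β / 8` of the temperature, and the limit defining `d` says that
changing the temperature by a bounded factor changes the log-partition function by `O(d)`. The lower
bounds needed come from convexity, so upper deviations suffice. The condition is `γ / β` of order `1
+ L / d` together with `γ ^ 2 D / N` at most of order `d + L + β (R - R θ₀)`. Solving for the
largest such `β` yields `critTemp`, and `d / β` is then the announced rate.

The selected pair has a `β'` at least as large as this `β`, so its posterior inherits the rate.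
Pairs with `β ≥ γ / 2` need no deviation event, and the budget they leave pays for the seven
localization events. -/

namespace GibbsMargin

/-! ### Bounded functions, log-partition functions and tilted measures. -/

/-- Bounded measurable real functions. -/
def BddMeas {α : Type*} [MeasurableSpace α] (g : α → ℝ) : Prop :=
  Measurable g ∧ ∃ C, ∀ x, |g x| ≤ C

namespace BddMeas

variable {α : Type*} [MeasurableSpace α] {g h : α → ℝ}

theorem const (c : ℝ) : BddMeas (fun _ : α => c) :=
  ⟨measurable_const, |c|, fun _ => le_rfl⟩

theorem add (hg : BddMeas g) (hh : BddMeas h) : BddMeas (fun x => g x + h x) := by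
  obtain ⟨C, hC⟩ := hg.2
  obtain ⟨D, hD⟩ := hh.2
  exact ⟨hg.1.add hh.1, C + D, fun x => (abs_add_le _ _).trans (add_le_add (hC x) (hD x))⟩

theorem const_mul (hg : BddMeas g) (c : ℝ) : BddMeas (fun x => c * g x) := by
  obtain ⟨C, hC⟩ := hg.2
  exact ⟨hg.1.const_mul c, |c| * C, fun x => by
    rw [abs_mul]; exact mul_le_mul_of_nonneg_left (hC x) (abs_nonneg c)⟩

theorem neg (hg : BddMeas g) : BddMeas (fun x => -g x) := by
  simpa using hg.const_mul (-1)

theorem sub (hg : BddMeas g) (hh : BddMeas h) : BddMeas (fun x => g x - h x) := by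
  simpa [sub_eq_add_neg] using hg.add hh.neg

theorem integrable (hg : BddMeas g) (μ : Measure α) [IsFiniteMeasure μ] : Integrable g μ := by
  obtain ⟨C, hC⟩ := hg.2
  exact Integrable.of_bound hg.1.aestronglyMeasurable C (ae_of_all _ fun x => hC x)

theorem exp (hg : BddMeas g) : BddMeas (fun x => Real.exp (g x)) := by
  obtain ⟨C, hC⟩ := hg.2
  refine ⟨Real.measurable_exp.comp hg.1, Real.exp C, fun x => ?_⟩
  rw [abs_of_pos (Real.exp_pos _)]
  exact Real.exp_le_exp.2 ((le_abs_self _).trans (hC x))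

theorem isProbabilityMeasure_tilted (hg : BddMeas g) (μ : Measure α) [IsProbabilityMeasure μ] :
    IsProbabilityMeasure (μ.tilted g) :=
  MeasureTheory.isProbabilityMeasure_tilted (hg.exp.integrable μ)

theorem integral_exp_pos (hg : BddMeas g) (μ : Measure α) [IsProbabilityMeasure μ] :
    0 < ∫ x, Real.exp (g x) ∂μ :=
  MeasureTheory.integral_exp_pos (hg.exp.integrable μ)

theorem prod_right {β : Type*} [MeasurableSpace β] {k : α × β → ℝ} (hk : BddMeas k) (a : α) :
    BddMeas (fun b => k (a, b)) := by
  obtain ⟨C, hC⟩ := hk.2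
  exact ⟨hk.1.comp measurable_prodMk_left, C, fun b => hC (a, b)⟩

theorem integral_prod_right {β : Type*} [MeasurableSpace β] {k : α × β → ℝ} (hk : BddMeas k)
    (μ : Measure β) [IsProbabilityMeasure μ] : BddMeas (fun a => ∫ b, k (a, b) ∂μ) := by
  obtain ⟨C, hC⟩ := hk.2
  refine ⟨hk.1.stronglyMeasurable.integral_prod_right'.measurable, C, fun a => ?_⟩
  simpa using norm_integral_le_of_norm_le_const (μ := μ) (f := fun b => k (a, b))
    (ae_of_all _ fun b => hC (a, b))

end BddMeas

/-- The logarithm of the partition function of `exp g` with respect to `μ`. -/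
noncomputable def logZ {α : Type*} [MeasurableSpace α] (μ : Measure α) (g : α → ℝ) : ℝ :=
  Real.log (∫ x, Real.exp (g x) ∂μ)

variable {α : Type*} [MeasurableSpace α]

theorem exp_logZ {g : α → ℝ} (hg : BddMeas g) (μ : Measure α) [IsProbabilityMeasure μ] :
    Real.exp (logZ μ g) = ∫ x, Real.exp (g x) ∂μ :=
  Real.exp_log (hg.integral_exp_pos μ)

theorem integral_le_logZ {g : α → ℝ} (hg : BddMeas g) (μ : Measure α) [IsProbabilityMeasure μ] :
    ∫ x, g x ∂μ ≤ logZ μ g := by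
  rw [logZ, Real.le_log_iff_exp_le (hg.integral_exp_pos μ)]
  set m := ∫ x, g x ∂μ with hm
  -- Jensen's inequality, by integrating the tangent of `exp` at the mean `m`.
  have h1 : ∫ x, Real.exp m * (1 + (g x - m)) ∂μ ≤ ∫ x, Real.exp (g x) ∂μ := by
    refine integral_mono ?_ (hg.exp.integrable μ) fun x => ?_
    · exact (((BddMeas.const 1).add (hg.sub (BddMeas.const m))).const_mul _).integrable μ
    · have := Real.add_one_le_exp (g x - m)
      calc Real.exp m * (1 + (g x - m)) ≤ Real.exp m * Real.exp (g x - m) :=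
            mul_le_mul_of_nonneg_left (by linarith) (Real.exp_pos _).le
        _ = Real.exp (g x) := by rw [← Real.exp_add]; ring_nf
  rw [integral_const_mul, integral_add (integrable_const _)
    ((hg.sub (BddMeas.const m)).integrable μ), integral_sub (hg.integrable μ)
    (integrable_const _)] at h1
  simpa [← hm] using h1

theorem logZ_mono {g h : α → ℝ} (hg : BddMeas g) (hh : BddMeas h) (μ : Measure α)
    [IsProbabilityMeasure μ] (hgh : ∀ x, g x ≤ h x) : logZ μ g ≤ logZ μ h :=
  Real.log_le_log (hg.integral_exp_pos μ)
    (integral_mono (hg.exp.integrable μ) (hh.exp.integrable μ) fun x =>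
      Real.exp_le_exp.2 (hgh x))

theorem logZ_add_const (g : α → ℝ) (hg : BddMeas g) (c : ℝ) (μ : Measure α)
    [IsProbabilityMeasure μ] : logZ μ (fun x => g x + c) = logZ μ g + c := by
  simp only [logZ, Real.exp_add, integral_mul_const]
  rw [Real.log_mul (hg.integral_exp_pos μ).ne' (Real.exp_pos c).ne', Real.log_exp]

theorem logZ_tilted {g h : α → ℝ} (hg : BddMeas g) (hh : BddMeas h) (μ : Measure α)
    [IsProbabilityMeasure μ] :
    logZ (μ.tilted g) h = logZ μ (fun x => g x + h x) - logZ μ g := by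
  have := (hg.add hh).integral_exp_pos μ
  simp only [logZ]
  rw [integral_exp_tilted]
  exact Real.log_div this.ne' (hg.integral_exp_pos μ).ne'

/-- The logarithmic partition function lies above its tangents. -/
theorem logZ_add_integral_le {g h : α → ℝ} (hg : BddMeas g) (hh : BddMeas h) (μ : Measure α)
    [IsProbabilityMeasure μ] :
    logZ μ g + ∫ x, (h x - g x) ∂(μ.tilted g) ≤ logZ μ h := by
  have := hg.isProbabilityMeasure_tilted μ
  have h1 := integral_le_logZ (hh.sub hg) (μ.tilted g)
  rw [logZ_tilted hg (hh.sub hg)] at h1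
  simp only [add_sub_cancel] at h1
  linarith

theorem tilted_add_const (g : α → ℝ) (c : ℝ) (μ : Measure α) :
    μ.tilted (fun x => g x + c) = μ.tilted g := by
  simp only [Measure.tilted, Real.exp_add, integral_mul_const]
  congr 1
  ext x
  rw [mul_div_mul_right _ _ (Real.exp_pos c).ne']

/-- The Kullback divergence between two tilted measures. -/
theorem klDiv_tilted_tilted {g h : α → ℝ} (hg : BddMeas g) (hh : BddMeas h) (μ : Measure α)
    [IsProbabilityMeasure μ] :
    InformationTheory.klDiv (μ.tilted g) (μ.tilted h) =
      ENNReal.ofReal (∫ x, (g x - h x) ∂(μ.tilted g) - logZ μ g + logZ μ h) := by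
  have hpg := hg.isProbabilityMeasure_tilted μ
  have hph := hh.isProbabilityMeasure_tilted μ
  have hgi := hg.exp.integrable μ
  have hhi := hh.exp.integrable μ
  have hac : μ.tilted g ≪ μ.tilted h :=
    (tilted_absolutelyContinuous μ g).trans (absolutelyContinuous_tilted hhi)
  have hllr : llr (μ.tilted g) (μ.tilted h) =ᵐ[μ.tilted g]
      fun x => g x - h x - logZ μ g + logZ μ h := by
    -- The first measure is the second one tilted by `g - h`, which makes the log-likelihood ratio
    -- explicit.
    have e1 : μ.tilted g = (μ.tilted h).tilted (fun x => g x - h x) := by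
      rw [tilted_tilted hhi]
      congr 1
      ext x
      simp
    have e2 := log_rnDeriv_tilted_left_self (μ := μ.tilted h) (f := fun x => g x - h x)
      ((hg.sub hh).exp.integrable _)
    rw [← e1] at e2
    have e3 := logZ_tilted hh (hg.sub hh) μ
    filter_upwards [hac.ae_le e2] with x hx
    rw [llr_def]
    simp only
    rw [hx]
    change g x - h x - logZ (μ.tilted h) (fun x => g x - h x) = _
    rw [e3]
    simp only [add_sub_cancel]
    ring
  have hint : BddMeas (fun x => g x - h x - logZ μ g + logZ μ h) :=
    ((hg.sub hh).sub (BddMeas.const _)).add (BddMeas.const _)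
  rw [InformationTheory.klDiv_of_ac_of_integrable hac
    ((hint.integrable _).congr hllr.symm), integral_congr_ae hllr]
  congr 1
  rw [integral_add (((hg.sub hh).sub (BddMeas.const _)).integrable _) (integrable_const _),
    integral_sub ((hg.sub hh).integrable _) (integrable_const _)]
  simp

theorem kl_tilted_nonneg {g h : α → ℝ} (hg : BddMeas g) (hh : BddMeas h) (μ : Measure α)
    [IsProbabilityMeasure μ] :
    0 ≤ ∫ x, (g x - h x) ∂(μ.tilted g) - logZ μ g + logZ μ h := by
  have h1 := logZ_add_integral_le hg hh μ
  have h2 : ∫ x, (g x - h x) ∂(μ.tilted g) = -∫ x, (h x - g x) ∂(μ.tilted g) := by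
    rw [← integral_neg]; simp
  linarith

/-- Markov's inequality for random logarithmic partition functions. -/
theorem measure_logZ_gt_le {Ω : Type*} [MeasurableSpace Ω] (P : Measure Ω)
    [IsProbabilityMeasure P] (μ : Measure α) [IsProbabilityMeasure μ] {Φ : Ω → α → ℝ} {h : α → ℝ}
    (hΦm : Measurable (Function.uncurry Φ)) (hΦ : ∀ z, BddMeas (Φ z)) (hh : BddMeas h)
    (hle : ∀ x, ∫⁻ z, ENNReal.ofReal (Real.exp (Φ z x)) ∂P ≤ ENNReal.ofReal (Real.exp (h x)))
    (l : ℝ) :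
    P {z | logZ μ h + l < logZ μ (Φ z)} ≤ ENNReal.ofReal (Real.exp (-l)) := by
  have key : ∀ k : α → ℝ, BddMeas k → ∫⁻ x, ENNReal.ofReal (Real.exp (k x)) ∂μ =
      ENNReal.ofReal (Real.exp (logZ μ k)) := by
    intro k hk
    rw [exp_logZ hk, ofReal_integral_eq_lintegral_ofReal (hk.exp.integrable μ)
      (ae_of_all _ fun x => (Real.exp_pos _).le)]
  have hm : Measurable (fun p : Ω × α => ENNReal.ofReal (Real.exp (Φ p.1 p.2))) :=
    (Real.measurable_exp.comp hΦm).ennreal_ofReal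
  -- Since `μ` does not depend on the sample, Tonelli moves the expectation inside the partition
  -- function.
  have hJ : ∫⁻ z, ENNReal.ofReal (Real.exp (logZ μ (Φ z))) ∂P ≤
      ENNReal.ofReal (Real.exp (logZ μ h)) := by
    calc _ = ∫⁻ z, ∫⁻ x, ENNReal.ofReal (Real.exp (Φ z x)) ∂μ ∂P := by
          simp_rw [← key _ (hΦ _)]
      _ = ∫⁻ x, ∫⁻ z, ENNReal.ofReal (Real.exp (Φ z x)) ∂P ∂μ :=
          lintegral_lintegral_swap hm.aemeasurable
      _ ≤ ∫⁻ x, ENNReal.ofReal (Real.exp (h x)) ∂μ := lintegral_mono hle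
      _ = _ := key h hh
  have hJm : Measurable fun z => ENNReal.ofReal (Real.exp (logZ μ (Φ z))) := by
    simp_rw [← key _ (hΦ _)]
    exact hm.lintegral_prod_right'
  have hpos : 0 < Real.exp (logZ μ h + l) := Real.exp_pos _
  calc P {z | logZ μ h + l < logZ μ (Φ z)}
      ≤ P {z | ENNReal.ofReal (Real.exp (logZ μ h + l)) ≤
          ENNReal.ofReal (Real.exp (logZ μ (Φ z)))} :=
        measure_mono fun z hz => ENNReal.ofReal_le_ofReal (Real.exp_le_exp.2 (le_of_lt hz))
    _ ≤ (∫⁻ z, ENNReal.ofReal (Real.exp (logZ μ (Φ z))) ∂P) /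
          ENNReal.ofReal (Real.exp (logZ μ h + l)) :=
        meas_ge_le_lintegral_div hJm.aemeasurable (by simpa using hpos) ENNReal.ofReal_ne_top
    _ ≤ ENNReal.ofReal (Real.exp (logZ μ h)) / ENNReal.ofReal (Real.exp (logZ μ h + l)) := by
        gcongr
    _ = ENNReal.ofReal (Real.exp (-l)) := by
        rw [← ENNReal.ofReal_div_of_pos hpos, ← Real.exp_sub]
        ring_nf

/-! ### Convexity of log-partition functions in the temperatures. -/

section Localization

variable {Θ : Type*} [MeasurableSpace Θ]

/-- The linear combination `a R + b r + c m`. -/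
def lin (R r m : Θ → ℝ) (a b c : ℝ) (θ : Θ) : ℝ := a * R θ + b * r θ + c * m θ

variable {R r m : Θ → ℝ}

theorem BddMeas.lin (hR : BddMeas R) (hr : BddMeas r) (hm : BddMeas m) (a b c : ℝ) :
    BddMeas (lin R r m a b c) :=
  ((hR.const_mul a).add (hr.const_mul b)).add (hm.const_mul c)

theorem BddMeas.gibbs {h : Θ → ℝ} (hh : BddMeas h) (l : ℝ) (π : Measure Θ)
    [IsProbabilityMeasure π] : IsProbabilityMeasure (gibbs π h l) :=
  (hh.const_mul l).neg.isProbabilityMeasure_tilted π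

/-- The gradient of the log-partition function in `(a, b, c)` is the vector of means of `R`, `r`,
`m`. Every comparison of Gibbs means below is a sum of such tangent inequalities. -/
theorem logZ_lin_tangent (hR : BddMeas R) (hr : BddMeas r) (hm : BddMeas m) (π : Measure Θ)
    [IsProbabilityMeasure π] (a b c a' b' c' : ℝ) :
    logZ π (lin R r m a b c)
      + ((a' - a) * ∫ θ, R θ ∂(π.tilted (lin R r m a b c))
        + (b' - b) * ∫ θ, r θ ∂(π.tilted (lin R r m a b c))
        + (c' - c) * ∫ θ, m θ ∂(π.tilted (lin R r m a b c)))
      ≤ logZ π (lin R r m a' b' c') := by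
  have hl := hR.lin hr hm a b c
  have := hl.isProbabilityMeasure_tilted π
  have h := logZ_add_integral_le hl (hR.lin hr hm a' b' c') π
  have e : ∀ θ, lin R r m a' b' c' θ - lin R r m a b c θ =
      (a' - a) * R θ + (b' - b) * r θ + (c' - c) * m θ := fun θ => by
    simp only [lin]; ring
  simp only [e] at h
  rw [integral_add (((hR.const_mul _).add (hr.const_mul _)).integrable _)
    ((hm.const_mul _).integrable _), integral_add ((hR.const_mul _).integrable _)
    ((hr.const_mul _).integrable _)] at h
  simpa only [integral_const_mul] using h

theorem tilted_lin_fst (R r m : Θ → ℝ) (π : Measure Θ) (v : ℝ) :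
    π.tilted (lin R r m (-v) 0 0) = gibbs π R v := by
  unfold gibbs
  congr 1
  ext θ
  simp [lin]

theorem tilted_lin_snd (R r m : Θ → ℝ) (π : Measure Θ) (v : ℝ) :
    π.tilted (lin R r m 0 (-v) 0) = gibbs π r v := by
  unfold gibbs
  congr 1
  ext θ
  simp [lin]

variable {d β : ℝ}

/-- The derivative in the inverse temperature is minus the mean of `R`, which the dimension bound
makes at most `2 * d / s` in size. The tangent at `s` alone suffices. -/
theorem logZ_sub_le_of_dim (hR : BddMeas R) (hr : BddMeas r) (hm : BddMeas m) (π : Measure Θ)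
    [IsProbabilityMeasure π] (hR0 : ∀ θ, 0 ≤ R θ)
    (hup : ∀ s, β ≤ s → s * ∫ θ, R θ ∂(gibbs π R s) ≤ 2 * d) {v s k : ℝ} (hs : β ≤ s)
    (hk : 0 ≤ k) (hvs : v - s ≤ k * s) :
    logZ π (lin R r m (-s) 0 0) ≤ logZ π (lin R r m (-v) 0 0) + 2 * d * k := by
  have h := logZ_lin_tangent hR hr hm π (-s) 0 0 (-v) 0 0
  rw [tilted_lin_fst] at h
  have h1 : 0 ≤ ∫ θ, R θ ∂(gibbs π R s) := integral_nonneg hR0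
  have h2 := hup s hs
  have h3 : (v - s) * ∫ θ, R θ ∂(gibbs π R s) ≤ k * s * ∫ θ, R θ ∂(gibbs π R s) :=
    mul_le_mul_of_nonneg_right hvs h1
  have h4 : k * (s * ∫ θ, R θ ∂(gibbs π R s)) ≤ k * (2 * d) := mul_le_mul_of_nonneg_left h2 hk
  nlinarith

/-- Midpoint convexity: `(-v, 0)` is the middle of `(0, -v)` and `(-2v, v)`. An upper bound on one
random partition function thus gives a lower bound on another. -/
theorem neg_logZ_snd_le (hR : BddMeas R) (hr : BddMeas r) (hm : BddMeas m) (π : Measure Θ)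
    [IsProbabilityMeasure π] (v : ℝ) :
    2 * logZ π (lin R r m (-v) 0 0) ≤
      logZ π (lin R r m 0 (-v) 0) + logZ π (lin R r m (-(2 * v)) v 0) := by
  have h1 := logZ_lin_tangent hR hr hm π (-v) 0 0 0 (-v) 0
  have h2 := logZ_lin_tangent hR hr hm π (-v) 0 0 (-(2 * v)) v 0
  linarith

/-- The random log-partition functions that control the empirical bound are close to their
deterministic counterparts. -/
structure Localized (π : Measure Θ) (R r m : Θ → ℝ) (w β γ e : ℝ) : Prop where
  half_dist : logZ π (lin R r m 0 (-(γ / 2)) w) ≤ logZ π (lin R r m (-(γ / 2 - β / 8)) 0 0) + e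
  half : logZ π (lin R r m (-(2 * (γ / 2))) (γ / 2) 0) ≤
    logZ π (lin R r m (-(γ / 2 - β / 8)) 0 0) + e
  four_dist : logZ π (lin R r m 0 (-(4 * β)) w) ≤ logZ π (lin R r m (-(4 * β - β / 8)) 0 0) + e
  four : logZ π (lin R r m (-(2 * (4 * β))) (4 * β) 0) ≤
    logZ π (lin R r m (-(4 * β - β / 8)) 0 0) + e
  quarter : logZ π (lin R r m 0 (-(γ / 4)) 0) ≤ logZ π (lin R r m (-(γ / 4 - β / 8)) 0 0) + e
  eight_sub : logZ π (lin R r m (-(8 * β - γ)) (-γ) 0) ≤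
    logZ π (lin R r m (-(8 * β - β / 8)) 0 0) + e
  eight_add : logZ π (lin R r m (-(8 * β + γ)) γ 0) ≤
    logZ π (lin R r m (-(8 * β - β / 8)) 0 0) + e

variable {w γ l e : ℝ}

/-- The subtracted term is bounded below by `neg_logZ_snd_le`; undoing the shift `β / 8` costs `2 *
d / 16`, twice. -/
theorem logZ_dist_sub_le (hR : BddMeas R) (hr : BddMeas r) (hm : BddMeas m) (π : Measure Θ)
    [IsProbabilityMeasure π] (hR0 : ∀ θ, 0 ≤ R θ)
    (hup : ∀ s, β ≤ s → s * ∫ θ, R θ ∂(gibbs π R s) ≤ 2 * d) (hβ : 0 < β)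
    {v : ℝ} (hv : 4 * β ≤ v)
    (h1 : logZ π (lin R r m 0 (-v) w) ≤ logZ π (lin R r m (-(v - β / 8)) 0 0) + e)
    (h2 : logZ π (lin R r m (-(2 * v)) v 0) ≤ logZ π (lin R r m (-(v - β / 8)) 0 0) + e) :
    logZ π (lin R r m 0 (-v) w) - logZ π (lin R r m 0 (-v) 0) ≤ d / 4 + 2 * e := by
  have h3 := neg_logZ_snd_le hR hr hm π v
  have h4 := logZ_sub_le_of_dim hR hr hm π hR0 hup (v := v) (s := v - β / 8) (k := 1 / 16)
    (by linarith) (by norm_num) (by linarith)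
  linarith

/-- The mean is the slope at `γ / 2`, hence at most the difference quotient between `γ / 4` and `γ /
2`; both ends are localized. -/
theorem Localized.mean_half_le (hL : Localized π R r m w β γ e) (hR : BddMeas R) (hr : BddMeas r)
    (hm : BddMeas m) [IsProbabilityMeasure π] (hR0 : ∀ θ, 0 ≤ R θ)
    (hup : ∀ s, β ≤ s → s * ∫ θ, R θ ∂(gibbs π R s) ≤ 2 * d) (hd : 0 < d) (hβ : 0 < β)
    (hγ : 16 * β ≤ γ) :
    γ / 2 * ∫ θ, r θ ∂(gibbs π r (γ / 2)) ≤ 5 * d + 4 * e := by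
  have h1 := logZ_lin_tangent hR hr hm π 0 (-(γ / 2)) 0 0 (-(γ / 4)) 0
  rw [tilted_lin_snd] at h1
  have h2 := hL.quarter
  have h3 := neg_logZ_snd_le hR hr hm π (γ / 2)
  have h4 := hL.half
  have h5 := logZ_sub_le_of_dim hR hr hm π hR0 hup (v := γ / 2) (s := γ / 2 - β / 8) (k := 1 / 16)
    (by linarith) (by norm_num) (by linarith)
  -- Halving the temperature and shifting it by `β / 8` is a relative change of at most `11 / 10`
  -- because `γ ≥ 16 * β`.
  have h6 := logZ_sub_le_of_dim hR hr hm π hR0 hup (v := γ / 2) (s := γ / 4 - β / 8) (k := 11 / 10)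
    (by linarith) (by norm_num) (by linarith)
  linarith

/-- Under the non-random measure at `8 * β`, the means `x` of `R` and `y` of `r` nearly agree, and
`x` is at least `d / (16 * β)`. Convexity transfers this to the mean `y'` of `r` at `4 * β`. -/
theorem Localized.le_mean_four (hL : Localized π R r m w β γ e) (hR : BddMeas R) (hr : BddMeas r)
    (hm : BddMeas m) [IsProbabilityMeasure π] (hR0 : ∀ θ, 0 ≤ R θ)
    (hup : ∀ s, β ≤ s → s * ∫ θ, R θ ∂(gibbs π R s) ≤ 2 * d)
    (hlo : ∀ s, β ≤ s → d / 2 ≤ s * ∫ θ, R θ ∂(gibbs π R s)) (hd : 0 < d) (hβ : 0 < β)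
    (hγ : 16 * β ≤ γ) :
    γ * (d / (16 * β)) - (d + 5 * e) ≤ γ * ∫ θ, r θ ∂(gibbs π r (4 * β)) := by
  have h1 := logZ_lin_tangent hR hr hm π 0 (-(4 * β)) 0 (-(8 * β - γ)) (-γ) 0
  have h2 := logZ_lin_tangent hR hr hm π (-(8 * β)) 0 0 (-(8 * β + γ)) γ 0
  have h3 := logZ_lin_tangent hR hr hm π (-(8 * β)) 0 0 0 (-(4 * β)) 0
  have h4 := logZ_lin_tangent hR hr hm π 0 (-(4 * β)) 0 (-(8 * β)) 0 0
  have h5 := logZ_lin_tangent hR hr hm π (-(8 * β)) 0 0 (-(8 * β - γ)) (-γ) 0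
  rw [tilted_lin_snd] at h1 h4
  rw [tilted_lin_fst] at h2 h3 h5
  have h6 := hL.eight_sub
  have h7 := hL.eight_add
  have h8 := logZ_sub_le_of_dim hR hr hm π hR0 hup (v := 8 * β) (s := 8 * β - β / 8) (k := 1 / 16)
    (by linarith) (by norm_num) (by linarith)
  have h9 := hlo (8 * β) (by linarith)
  set x := ∫ θ, R θ ∂(gibbs π R (8 * β))
  set y := ∫ θ, r θ ∂(gibbs π R (8 * β))
  set x' := ∫ θ, R θ ∂(gibbs π r (4 * β))
  set y' := ∫ θ, r θ ∂(gibbs π r (4 * β))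
  have hx : γ * (d / (16 * β)) ≤ γ * x := by
    refine mul_le_mul_of_nonneg_left ?_ (by linarith)
    rw [div_le_iff₀ (by positivity)]
    linarith
  -- The ratio 2 of the temperatures `8 * β` and `4 * β` matters: replacing `x'` by `x - (y - y') /
  -- 2` in `h1` uses up only half of `y'`.
  have hxy : 2 * (x - x') ≤ y - y' := by
    have : β * (2 * (x - x')) ≤ β * (y - y') := by linarith
    exact le_of_mul_le_mul_left this hβ
  have hprod : (γ - 8 * β) * (2 * (x - x')) ≤ (γ - 8 * β) * (y - y') :=
    mul_le_mul_of_nonneg_left hxy (by linarith)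
  linarith

end Localization

/-! ### Errors, risks and empirical distances: bounds and measurability. -/

section Sample

variable {X Y Θ : Type*}

theorem err_eq_zero_or_one (f : Θ → X → Y) (θ : Θ) (p : X × Y) :
    err f θ p = 0 ∨ err f θ p = 1 := by
  unfold err
  split_ifs <;> simp

theorem abs_err_le_one (f : Θ → X → Y) (θ : Θ) (p : X × Y) : |err f θ p| ≤ 1 := by
  rcases err_eq_zero_or_one f θ p with h | h <;> simp [h]

theorem err_sub_cases (f : Θ → X → Y) (θ θ' : Θ) (p : X × Y) :
    err f θ p - err f θ' p = 0 ∨ err f θ p - err f θ' p = 1 ∨ err f θ p - err f θ' p = -1 := by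
  rcases err_eq_zero_or_one f θ p with h | h <;> rcases err_eq_zero_or_one f θ' p with h' | h' <;>
    simp [h, h']

theorem err_sub_sq_le_one (f : Θ → X → Y) (θ θ' : Θ) (p : X × Y) :
    (err f θ p - err f θ' p) ^ 2 ≤ 1 := by
  rcases err_sub_cases f θ θ' p with h | h | h <;> simp [h]

theorem err_sub_sq_triangle (f : Θ → X → Y) (θ θ' θ'' : Θ) (p : X × Y) :
    (err f θ p - err f θ' p) ^ 2 ≤
      (err f θ p - err f θ'' p) ^ 2 + (err f θ' p - err f θ'' p) ^ 2 := by
  rcases err_eq_zero_or_one f θ p with h | h <;> rcases err_eq_zero_or_one f θ' p with h' | h' <;>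
    rcases err_eq_zero_or_one f θ'' p with h'' | h'' <;> norm_num [h, h', h'']

section Empirical

variable (f : Θ → X → Y) {N : ℕ} (z : Fin N → X × Y)

theorem empRisk_sub (θ θ' : Θ) : empRisk f z θ - empRisk f z θ' =
    (1 / (N : ℝ)) * ∑ i, (err f θ (z i) - err f θ' (z i)) := by
  simp only [empRisk, Finset.sum_sub_distrib]
  ring

theorem inv_mul_sum_le_one {N : ℕ} (a : Fin N → ℝ) (ha : ∀ i, a i ≤ 1) :
    (1 / (N : ℝ)) * ∑ i, a i ≤ 1 := by
  rcases Nat.eq_zero_or_pos N with rfl | hN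
  · simp
  · have hN' : (0 : ℝ) < N := by exact_mod_cast hN
    have : ∑ i, a i ≤ N := by simpa using Finset.sum_le_sum (s := Finset.univ) fun i _ => ha i
    rw [one_div, inv_mul_le_iff₀ hN', mul_one]
    exact this

theorem empRisk_nonneg (θ : Θ) : 0 ≤ empRisk f z θ := by
  refine mul_nonneg (by positivity) (Finset.sum_nonneg fun i _ => ?_)
  rcases err_eq_zero_or_one f θ (z i) with h | h <;> simp [h]

theorem empRisk_le_one (θ : Θ) : empRisk f z θ ≤ 1 :=
  inv_mul_sum_le_one _ fun i => (le_abs_self _).trans (abs_err_le_one f θ (z i))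

theorem empDist_nonneg (θ θ' : Θ) : 0 ≤ empDist f z θ θ' :=
  mul_nonneg (by positivity) (Finset.sum_nonneg fun i _ => sq_nonneg _)

theorem empDist_le_one (θ θ' : Θ) : empDist f z θ θ' ≤ 1 :=
  inv_mul_sum_le_one _ fun i => err_sub_sq_le_one f θ θ' (z i)

theorem empDist_comm (θ θ' : Θ) : empDist f z θ θ' = empDist f z θ' θ := by
  unfold empDist
  congr 1
  exact Finset.sum_congr rfl fun i _ => by ring

theorem empDist_triangle (θ θ' θ'' : Θ) :
    empDist f z θ θ' ≤ empDist f z θ θ'' + empDist f z θ' θ'' := by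
  unfold empDist
  rw [← mul_add, ← Finset.sum_add_distrib]
  exact mul_le_mul_of_nonneg_left
    (Finset.sum_le_sum fun i _ => err_sub_sq_triangle f θ θ' θ'' (z i)) (by positivity)

end Empirical

theorem emp_combination_eq (f : Θ → X → Y) {N : ℕ} (hN : 0 < N) (z : Fin N → X × Y) (θ θ' : Θ)
    (t u : ℝ) :
    -(t * (empRisk f z θ - empRisk f z θ')) + u * empDist f z θ θ' =
      ∑ i, (-(t / N * (err f θ (z i) - err f θ' (z i)))
        + u / N * (err f θ (z i) - err f θ' (z i)) ^ 2) := by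
  rw [empRisk_sub, empDist, Finset.sum_add_distrib, Finset.sum_neg_distrib, ← Finset.mul_sum,
    ← Finset.mul_sum]
  have : (N : ℝ) ≠ 0 := by positivity
  field_simp

theorem one_sub_tanh_mul_pos (y : ℝ) {x : ℝ} (hx : |x| ≤ 1) : 0 < 1 - Real.tanh y * x := by
  have h := Real.abs_tanh_lt_one y
  have : |Real.tanh y * x| < 1 := by
    rw [abs_mul]
    calc |Real.tanh y| * |x| ≤ |Real.tanh y| * 1 :=
          mul_le_mul_of_nonneg_left hx (abs_nonneg _)
      _ < 1 := by simpa using h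
  linarith [(abs_lt.1 this).2]

section Bounds

variable [MeasurableSpace X] [MeasurableSpace Y] {f : Θ → X → Y}

theorem risk_nonneg {N : ℕ} (P : Fin N → Measure (X × Y)) (θ : Θ) : 0 ≤ risk f P θ :=
  mul_nonneg (by positivity) (Finset.sum_nonneg fun i _ => measureReal_nonneg)

theorem risk_le_one {N : ℕ} (P : Fin N → Measure (X × Y)) [∀ i, IsProbabilityMeasure (P i)]
    (θ : Θ) : risk f P θ ≤ 1 :=
  inv_mul_sum_le_one _ fun _ => measureReal_le_one

theorem disagreement_nonneg {N : ℕ} (P : Fin N → Measure (X × Y)) (θ θ' : Θ) :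
    0 ≤ disagreement f P θ θ' :=
  mul_nonneg (by positivity) (Finset.sum_nonneg fun i _ => measureReal_nonneg)

theorem disagreement_le_one {N : ℕ} (P : Fin N → Measure (X × Y))
    [∀ i, IsProbabilityMeasure (P i)] (θ θ' : Θ) : disagreement f P θ θ' ≤ 1 :=
  inv_mul_sum_le_one _ fun _ => measureReal_le_one

theorem abs_risk_sub_le_one {N : ℕ} (P : Fin N → Measure (X × Y))
    [∀ i, IsProbabilityMeasure (P i)] (θ θ' : Θ) : |risk f P θ - risk f P θ'| ≤ 1 := by
  rw [abs_le]
  constructor <;> linarith [risk_nonneg (f := f) P θ, risk_nonneg (f := f) P θ',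
    risk_le_one (f := f) P θ, risk_le_one (f := f) P θ']

end Bounds

section Measurability

variable [MeasurableSpace X] [Finite Y] [MeasurableSpace Y] [DiscreteMeasurableSpace Y]
  [MeasurableSpace Θ] {f : Θ → X → Y}

theorem measurable_err (hf : Measurable (Function.uncurry f)) :
    Measurable (fun q : Θ × (X × Y) => err f q.1 q.2) := by
  have hp : Measurable (fun q : Θ × (X × Y) => (f q.1 q.2.1, q.2.2)) :=
    (hf.comp (measurable_fst.prodMk (measurable_fst.comp measurable_snd))).prodMk
      (measurable_snd.comp measurable_snd)
  have hg : Measurable (fun y : Y × Y => by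
      classical exact (if y.1 ≠ y.2 then (1 : ℝ) else 0)) := measurable_of_finite _
  exact hg.comp hp

theorem measurable_err_apply (hf : Measurable (Function.uncurry f)) (θ : Θ) :
    Measurable (err f θ) := (measurable_err hf).comp measurable_prodMk_left

theorem measurable_empRisk (hf : Measurable (Function.uncurry f)) (N : ℕ) :
    Measurable (fun q : (Fin N → X × Y) × Θ => empRisk f q.1 q.2) := by
  unfold empRisk
  refine (Finset.measurable_sum _ fun i _ => ?_).const_mul _
  exact (measurable_err hf).comp
    (measurable_snd.prodMk ((measurable_pi_apply i).comp measurable_fst))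

theorem measurable_empDist (hf : Measurable (Function.uncurry f)) (N : ℕ) :
    Measurable (fun q : (Fin N → X × Y) × (Θ × Θ) => empDist f q.1 q.2.1 q.2.2) := by
  have hz : ∀ i, Measurable (fun q : (Fin N → X × Y) × (Θ × Θ) => q.1 i) := fun i =>
    (measurable_pi_apply i).comp measurable_fst
  have h1 : ∀ i, Measurable (fun q : (Fin N → X × Y) × (Θ × Θ) => err f q.2.1 (q.1 i)) :=
    fun i => (measurable_err hf).comp ((measurable_fst.comp measurable_snd).prodMk (hz i))
  have h2 : ∀ i, Measurable (fun q : (Fin N → X × Y) × (Θ × Θ) => err f q.2.2 (q.1 i)) :=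
    fun i => (measurable_err hf).comp ((measurable_snd.comp measurable_snd).prodMk (hz i))
  have h3 : ∀ i, Measurable (fun q : (Fin N → X × Y) × (Θ × Θ) =>
      (err f q.2.1 (q.1 i) - err f q.2.2 (q.1 i)) ^ 2) := fun i => ((h1 i).sub (h2 i)).pow_const 2
  have h4 : Measurable (fun q : (Fin N → X × Y) × (Θ × Θ) =>
      ∑ i, (err f q.2.1 (q.1 i) - err f q.2.2 (q.1 i)) ^ 2) :=
    Finset.measurable_sum _ fun i _ => h3 i
  exact h4.const_mul (1 / (N : ℝ))

theorem bddMeas_empRisk (hf : Measurable (Function.uncurry f)) {N : ℕ} (z : Fin N → X × Y) :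
    BddMeas (empRisk f z) :=
  ⟨(measurable_empRisk hf N).comp measurable_prodMk_left, 1, fun θ => by
    rw [abs_of_nonneg (empRisk_nonneg f z θ)]; exact empRisk_le_one f z θ⟩

theorem bddMeas_empDist (hf : Measurable (Function.uncurry f)) {N : ℕ} (z : Fin N → X × Y) :
    BddMeas (fun q : Θ × Θ => empDist f z q.1 q.2) := by
  refine ⟨?_, 1, fun q => ?_⟩
  · have h : Measurable (fun q : Θ × Θ => (z, q)) := measurable_prodMk_left
    have h' := (measurable_empDist hf N).comp h
    simpa only [Function.comp_def] using h'
  · rw [abs_of_nonneg (empDist_nonneg f z _ _)]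
    exact empDist_le_one f z _ _

theorem integral_err (hf : Measurable (Function.uncurry f)) (μ : Measure (X × Y)) (θ : Θ) :
    ∫ p, err f θ p ∂μ = μ.real {p | f θ p.1 ≠ p.2} := by
  have hs : MeasurableSet {p : X × Y | f θ p.1 ≠ p.2} := by
    have h := (measurable_err_apply hf θ) (measurableSet_singleton (1 : ℝ))
    convert h using 1
    ext p
    simp [err]
  rw [← integral_indicator_one hs]
  congr 1
  ext p
  simp [err, Set.indicator]

theorem bddMeas_err (hf : Measurable (Function.uncurry f)) (θ : Θ) : BddMeas (err f θ) :=
  ⟨measurable_err_apply hf θ, 1, abs_err_le_one f θ⟩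

theorem bddMeas_err_sub_sq (hf : Measurable (Function.uncurry f)) (θ θ' : Θ) :
    BddMeas (fun p => (err f θ p - err f θ' p) ^ 2) :=
  ⟨((measurable_err_apply hf θ).sub (measurable_err_apply hf θ')).pow_const 2, 1, fun p => by
    rw [abs_of_nonneg (sq_nonneg _)]; exact err_sub_sq_le_one f θ θ' p⟩

/-- The errors of two rules can differ only where the rules disagree. -/
theorem integral_err_sub_sq_le (hf : Measurable (Function.uncurry f)) (μ : Measure (X × Y))
    [IsProbabilityMeasure μ] (θ θ' : Θ) :
    ∫ p, (err f θ p - err f θ' p) ^ 2 ∂μ ≤ μ.real {p | f θ p.1 ≠ f θ' p.1} := by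
  have hs : MeasurableSet {p : X × Y | f θ p.1 ≠ f θ' p.1} := by
    have hp : Measurable (fun q : X × Y => (f θ q.1, f θ' q.1)) :=
      ((hf.comp measurable_prodMk_left).comp measurable_fst).prodMk
        ((hf.comp measurable_prodMk_left).comp measurable_fst)
    exact hp (MeasurableSet.of_discrete (s := {y : Y × Y | y.1 ≠ y.2}))
  rw [← integral_indicator_one hs]
  refine integral_mono ((bddMeas_err_sub_sq hf θ θ').integrable μ)
    ((integrable_const (1 : ℝ)).indicator hs) fun p => ?_
  by_cases h : f θ p.1 = f θ' p.1
  · have : err f θ p = err f θ' p := by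
      by_cases hy : f θ' p.1 = p.2 <;> simp [err, h, hy]
    simp [this, h]
  · simpa [Set.indicator, h] using err_sub_sq_le_one f θ θ' p

theorem risk_eq (hf : Measurable (Function.uncurry f)) {N : ℕ} (P : Fin N → Measure (X × Y))
    (θ : Θ) : risk f P θ = (1 / (N : ℝ)) * ∑ i, ∫ p, err f θ p ∂(P i) := by
  simp only [risk, integral_err hf]

theorem bddMeas_risk (hf : Measurable (Function.uncurry f)) {N : ℕ}
    (P : Fin N → Measure (X × Y)) [∀ i, IsProbabilityMeasure (P i)] : BddMeas (risk f P) := by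
  refine ⟨?_, 1, fun θ => by rw [abs_of_nonneg (risk_nonneg P θ)]; exact risk_le_one P θ⟩
  have : risk f P = fun θ => (1 / (N : ℝ)) * ∑ i, ∫ p, err f θ p ∂(P i) :=
    funext fun θ => risk_eq hf P θ
  rw [this]
  refine (Finset.measurable_sum _ fun i _ => ?_).const_mul _
  exact (measurable_err hf).stronglyMeasurable.integral_prod_right'.measurable

end Measurability

/-! ### Exponential moments of the empirical process. -/

section Moments

/-- Exponential moments of a sum of independent terms. -/
theorem lintegral_exp_sum {Z : Type*} [MeasurableSpace Z] {N : ℕ} (P : Fin N → Measure Z)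
    [∀ i, IsProbabilityMeasure (P i)] {g : Z → ℝ} (hg : BddMeas g) :
    ∫⁻ z, ENNReal.ofReal (Real.exp (∑ i, g (z i))) ∂(Measure.pi P) =
      ENNReal.ofReal (∏ i, ∫ p, Real.exp (g p) ∂(P i)) := by
  obtain ⟨C, hC⟩ := hg.2
  have hb : BddMeas (fun z : Fin N → Z => ∑ i, g (z i)) :=
    ⟨Finset.measurable_sum _ fun i _ => hg.1.comp (measurable_pi_apply i), ∑ _i : Fin N, C,
      fun z => (Finset.abs_sum_le_sum_abs _ _).trans (Finset.sum_le_sum fun i _ => hC _)⟩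
  rw [← ofReal_integral_eq_lintegral_ofReal (hb.exp.integrable _)
    (ae_of_all _ fun z => (Real.exp_pos _).le)]
  congr 1
  simp only [Real.exp_sum]
  exact integral_fintype_prod_eq_prod (fun _ p => Real.exp (g p))

/-- The arithmetic-geometric inequality, from `t ≤ exp (t - 1)`. It reduces observations with
different laws to their average law. -/
theorem prod_le_mean_pow {N : ℕ} (hN : 0 < N) (a : Fin N → ℝ) (ha : ∀ i, 0 ≤ a i) {b : ℝ}
    (hb : 0 < b) (hab : ∑ i, a i = N * b) : ∏ i, a i ≤ b ^ N := by
  have h1 : ∏ i, a i ≤ ∏ i, b * Real.exp (a i / b - 1) := by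
    refine Finset.prod_le_prod (fun i _ => ha i) fun i _ => ?_
    have := Real.add_one_le_exp (a i / b - 1)
    calc a i = b * (a i / b - 1 + 1) := by field_simp; ring
      _ ≤ _ := mul_le_mul_of_nonneg_left this hb.le
  refine h1.trans_eq ?_
  rw [Finset.prod_mul_distrib, ← Real.exp_sum, Finset.sum_sub_distrib, ← Finset.sum_div, hab]
  have : (N : ℝ) * b / b = N := by field_simp
  simp [this]

/-- For `s` in `{0, 1, -1}` the factor `exp (-log cosh y)` makes the exponential exactly affine in
`s`; this is the origin of `tanh` and `log cosh` in the bound. -/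
theorem exp_tilt_eq (y s : ℝ) (hs : s = 0 ∨ s = 1 ∨ s = -1) :
    Real.exp (-(y * s) - Real.log (Real.cosh y) * s ^ 2) = 1 - Real.tanh y * s := by
  have hc := Real.cosh_pos y
  rcases hs with rfl | rfl | rfl
  · simp
  · simp only [mul_one, one_pow]
    rw [Real.exp_sub, Real.exp_log hc, Real.tanh_eq_sinh_div_cosh, ← Real.cosh_sub_sinh]
    field_simp
  · norm_num
    rw [Real.exp_sub, Real.exp_log hc, Real.tanh_eq_sinh_div_cosh, ← Real.cosh_add_sinh]
    field_simp

theorem exp_le_one_add_add_sq {x : ℝ} (hx : |x| ≤ 1) : Real.exp x ≤ 1 + x + x ^ 2 := by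
  have := Real.abs_exp_sub_one_sub_id_le hx
  linarith [(abs_le.1 this).2]

/-- A second-order version that allows the quadratic term to have the unfavourable sign; the
constant 4 collects `x ^ 2 + y ^ 2 + x * y ^ 2 + x ^ 2 * y ^ 2` for `|x| ≤ y ≤ 1`. -/
theorem exp_tilt_le {y t u s : ℝ} (hy : 0 ≤ y) (hy1 : y ≤ 1) (ht : |t| ≤ y)
    (hu : u ≤ Real.log (Real.cosh y)) (hs : s = 0 ∨ s = 1 ∨ s = -1) :
    Real.exp (-(t * s) + u * s ^ 2) ≤ 1 - t * s + 4 * y ^ 2 * s ^ 2 := by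
  have key : ∀ x : ℝ, |x| ≤ y → Real.exp (x + u) ≤ 1 + x + 4 * y ^ 2 := by
    intro x hx
    have h1 := exp_le_one_add_add_sq (hx.trans hy1)
    have hx2 : x ^ 2 ≤ y ^ 2 := sq_le_sq' (by linarith [(abs_le.1 hx).1]) (abs_le.1 hx).2
    have hy2 : y ^ 2 ≤ 1 := by nlinarith
    have h2 : Real.exp u ≤ 1 + y ^ 2 := by
      calc Real.exp u ≤ Real.cosh y := by
            rw [← Real.exp_log (Real.cosh_pos y)]; exact Real.exp_le_exp.2 hu
        _ ≤ Real.exp (y ^ 2 / 2) := Real.cosh_le_exp_half_sq y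
        _ ≤ 1 + y ^ 2 / 2 + (y ^ 2 / 2) ^ 2 :=
            exp_le_one_add_add_sq (by rw [abs_of_nonneg (by positivity)]; linarith)
        _ ≤ 1 + y ^ 2 := by nlinarith [sq_nonneg y]
    have hx1 : x ≤ 1 := (abs_le.1 hx).2.trans hy1
    have h3 : 0 ≤ 1 + x + x ^ 2 := (Real.exp_pos x).le.trans h1
    calc Real.exp (x + u) = Real.exp x * Real.exp u := Real.exp_add _ _
      _ ≤ (1 + x + x ^ 2) * (1 + y ^ 2) := mul_le_mul h1 h2 (Real.exp_pos _).le h3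
      _ ≤ 1 + x + 4 * y ^ 2 := by nlinarith [sq_nonneg y, sq_nonneg x]
  rcases hs with rfl | rfl | rfl
  · simp
  · have := key (-t) (by rwa [abs_neg])
    simpa [sub_eq_add_neg] using this
  · have := key t ht
    simpa using this

variable [MeasurableSpace X] [Finite Y] [MeasurableSpace Y] [DiscreteMeasurableSpace Y]
  [MeasurableSpace Θ] {f : Θ → X → Y}

theorem bddMeas_tilt (hf : Measurable (Function.uncurry f)) (θ θ' : Θ) (t u : ℝ) :
    BddMeas (fun p => -(t * (err f θ p - err f θ' p)) + u * (err f θ p - err f θ' p) ^ 2) :=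
  (((bddMeas_err hf θ).sub (bddMeas_err hf θ')).const_mul t).neg.add
    ((bddMeas_err_sub_sq hf θ θ').const_mul u)

theorem risk_sub (hf : Measurable (Function.uncurry f)) {N : ℕ} (P : Fin N → Measure (X × Y))
    [∀ i, IsProbabilityMeasure (P i)] (θ θ' : Θ) :
    risk f P θ - risk f P θ' = (1 / (N : ℝ)) * ∑ i, ∫ p, (err f θ p - err f θ' p) ∂(P i) := by
  rw [risk_eq hf, risk_eq hf, ← mul_sub, ← Finset.sum_sub_distrib]
  congr 1
  exact Finset.sum_congr rfl fun i _ =>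
    (integral_sub ((bddMeas_err hf θ).integrable _) ((bddMeas_err hf θ').integrable _)).symm

/-- The exponential inequality behind the empirical bound. -/
theorem lintegral_exp_relative_le_one (hf : Measurable (Function.uncurry f)) {N : ℕ} (hN : 0 < N)
    (P : Fin N → Measure (X × Y)) [∀ i, IsProbabilityMeasure (P i)] (γ : ℝ) (θ θ' : Θ) :
    ∫⁻ z, ENNReal.ofReal (Real.exp
      (-(N : ℝ) * Real.log (1 - Real.tanh (γ / N) * (risk f P θ - risk f P θ'))
        - γ * (empRisk f z θ - empRisk f z θ')
        - N * Real.log (Real.cosh (γ / N)) * empDist f z θ θ')) ∂(Measure.pi P) ≤ 1 := by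
  have hN' : (0 : ℝ) < N := by exact_mod_cast hN
  set b := 1 - Real.tanh (γ / N) * (risk f P θ - risk f P θ') with hbdef
  have hb : 0 < b := one_sub_tanh_mul_pos _ (abs_risk_sub_le_one P θ θ')
  have hg := bddMeas_tilt hf θ θ' (γ / N) (-(N * Real.log (Real.cosh (γ / N))) / N)
  have e : ∀ z : Fin N → X × Y,
      ENNReal.ofReal (Real.exp (-(N : ℝ) * Real.log b - γ * (empRisk f z θ - empRisk f z θ')
        - N * Real.log (Real.cosh (γ / N)) * empDist f z θ θ')) =
      ENNReal.ofReal (Real.exp (-(N : ℝ) * Real.log b)) * ENNReal.ofReal (Real.exp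
        (∑ i, (-(γ / N * (err f θ (z i) - err f θ' (z i)))
        + -(N * Real.log (Real.cosh (γ / N))) / N * (err f θ (z i) - err f θ' (z i)) ^ 2))) := by
    intro z
    rw [← emp_combination_eq f hN, ← ENNReal.ofReal_mul (Real.exp_pos _).le, ← Real.exp_add]
    congr 2
    ring
  simp_rw [e]
  rw [lintegral_const_mul' _ _ ENNReal.ofReal_ne_top, lintegral_exp_sum P hg,
    ← ENNReal.ofReal_mul (Real.exp_pos _).le]
  rw [ENNReal.ofReal_le_one]
  have hint : ∀ i, ∫ p, Real.exp (-(γ / N * (err f θ p - err f θ' p))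
      + -(N * Real.log (Real.cosh (γ / N))) / N * (err f θ p - err f θ' p) ^ 2) ∂(P i) =
      1 - Real.tanh (γ / N) * ∫ p, (err f θ p - err f θ' p) ∂(P i) := by
    intro i
    have : ∀ p, Real.exp (-(γ / N * (err f θ p - err f θ' p))
      + -(N * Real.log (Real.cosh (γ / N))) / N * (err f θ p - err f θ' p) ^ 2) =
        1 - Real.tanh (γ / N) * (err f θ p - err f θ' p) := by
      intro p
      rw [← exp_tilt_eq _ _ (err_sub_cases f θ θ' p)]
      congr 1
      field_simp
      ring
    simp_rw [this]
    rw [integral_sub (integrable_const _)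
      ((((bddMeas_err hf θ).sub (bddMeas_err hf θ')).const_mul _).integrable _),
      integral_const_mul]
    simp
  have hprod : ∏ i, ∫ p, Real.exp (-(γ / N * (err f θ p - err f θ' p))
      + -(N * Real.log (Real.cosh (γ / N))) / N * (err f θ p - err f θ' p) ^ 2) ∂(P i) ≤ b ^ N := by
    refine prod_le_mean_pow hN _ (fun i => integral_nonneg fun p => (Real.exp_pos _).le) hb ?_
    simp_rw [hint]
    rw [hbdef, risk_sub hf, Finset.sum_sub_distrib, ← Finset.mul_sum]
    simp only [Finset.sum_const, Finset.card_univ, Fintype.card_fin, nsmul_eq_mul, mul_one]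
    field_simp
  calc _ ≤ Real.exp (-(N : ℝ) * Real.log b) * b ^ N :=
        mul_le_mul_of_nonneg_left hprod (Real.exp_pos _).le
    _ = 1 := by
        rw [← Real.rpow_natCast, Real.rpow_def_of_pos hb, ← Real.exp_add]
        ring_nf
        exact Real.exp_zero

/-- Exponential moments of the relative empirical risk. -/
theorem lintegral_exp_relative_le (hf : Measurable (Function.uncurry f)) {N : ℕ} (hN : 0 < N)
    (P : Fin N → Measure (X × Y)) [∀ i, IsProbabilityMeasure (P i)] {γ t u : ℝ} (hγ : 0 ≤ γ)
    (hγN : γ ≤ N) (ht : |t| ≤ γ) (hu : u ≤ N * Real.log (Real.cosh (γ / N)))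
    (θ θ' : Θ) :
    ∫⁻ z, ENNReal.ofReal (Real.exp
      (-(t * (empRisk f z θ - empRisk f z θ')) + u * empDist f z θ θ')) ∂(Measure.pi P) ≤
    ENNReal.ofReal (Real.exp (-(t * (risk f P θ - risk f P θ'))
      + 4 * (γ ^ 2 / N) * disagreement f P θ θ')) := by
  have hN' : (0 : ℝ) < N := by exact_mod_cast hN
  have hg := bddMeas_tilt hf θ θ' (t / N) (u / N)
  simp_rw [emp_combination_eq f hN]
  rw [lintegral_exp_sum P hg]
  refine ENNReal.ofReal_le_ofReal ?_
  have hψ := (bddMeas_err hf θ).sub (bddMeas_err hf θ')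
  have hψ2 := bddMeas_err_sub_sq hf θ θ'
  have hint : ∀ i, ∫ p, Real.exp (-(t / N * (err f θ p - err f θ' p))
      + u / N * (err f θ p - err f θ' p) ^ 2) ∂(P i) ≤
      Real.exp (-(t / N) * ∫ p, (err f θ p - err f θ' p) ∂(P i)
        + 4 * (γ / N) ^ 2 * (P i).real {p | f θ p.1 ≠ f θ' p.1}) := by
    intro i
    calc _ ≤ ∫ p, (1 - t / N * (err f θ p - err f θ' p)
          + 4 * (γ / N) ^ 2 * (err f θ p - err f θ' p) ^ 2) ∂(P i) := by
          refine integral_mono (hg.exp.integrable _)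
            ((((BddMeas.const 1).sub (hψ.const_mul _)).add (hψ2.const_mul _)).integrable _)
            fun p => ?_
          refine exp_tilt_le (by positivity) ((div_le_one hN').2 hγN) ?_ ?_
            (err_sub_cases f θ θ' p)
          · rw [abs_div, abs_of_pos hN']
            gcongr
          · rw [div_le_iff₀ hN']
            linarith
      _ = 1 - t / N * ∫ p, (err f θ p - err f θ' p) ∂(P i)
          + 4 * (γ / N) ^ 2 * ∫ p, (err f θ p - err f θ' p) ^ 2 ∂(P i) := by
          rw [integral_add (((BddMeas.const 1).sub (hψ.const_mul _)).integrable _)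
            ((hψ2.const_mul _).integrable _), integral_sub (integrable_const _)
            ((hψ.const_mul _).integrable _), integral_const_mul, integral_const_mul]
          simp
      _ ≤ 1 - t / N * ∫ p, (err f θ p - err f θ' p) ∂(P i)
          + 4 * (γ / N) ^ 2 * (P i).real {p | f θ p.1 ≠ f θ' p.1} := by
          have := integral_err_sub_sq_le hf (P i) θ θ'
          gcongr
      _ ≤ _ := by
          refine le_trans (le_of_eq ?_) (Real.add_one_le_exp _)
          ring
  refine (Finset.prod_le_prod (fun i _ => integral_nonneg fun p => (Real.exp_pos _).le)
    fun i _ => hint i).trans_eq ?_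
  rw [← Real.exp_sum, Finset.sum_add_distrib, ← Finset.mul_sum, ← Finset.mul_sum, risk_sub hf,
    disagreement]
  congr 1
  field_simp

end Moments

end Sample

/-! ### The function `devF` and its inverse. -/

section Tanh

theorem tanh_pos {y : ℝ} (hy : 0 < y) : 0 < Real.tanh y := by
  rw [Real.tanh_eq_sinh_div_cosh]
  exact div_pos (Real.sinh_pos_iff.2 hy) (Real.cosh_pos y)

theorem half_le_tanh {y : ℝ} (hy : 0 ≤ y) (hy1 : y ≤ 1) : y / 2 ≤ Real.tanh y := by
  have h1 : y ≤ Real.sinh y := Real.self_le_sinh_iff.2 hy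
  have h2 : Real.cosh y ≤ 2 := by
    have h := (Real.cosh_le_exp_half_sq y).trans (exp_le_one_add_add_sq
      (by rw [abs_of_nonneg (by positivity)]; nlinarith))
    have h3 : y ^ 2 ≤ 1 := by nlinarith
    nlinarith [sq_nonneg y]
  rw [Real.tanh_eq_sinh_div_cosh, le_div_iff₀ (Real.cosh_pos y)]
  nlinarith

theorem tanh_le_self {y : ℝ} (hy : 0 ≤ y) : Real.tanh y ≤ y := by
  rw [Real.tanh_eq_sinh_div_cosh, div_le_iff₀ (Real.cosh_pos y)]
  have hd : ∀ x, HasDerivAt (fun x => x * Real.cosh x - Real.sinh x) (x * Real.sinh x) x := by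
    intro x
    simpa using ((hasDerivAt_id' x).fun_mul (Real.hasDerivAt_cosh x)).fun_sub
      (Real.hasDerivAt_sinh x)
  have hm : MonotoneOn (fun x => x * Real.cosh x - Real.sinh x) (Set.Ici 0) := by
    refine monotoneOn_of_deriv_nonneg (convex_Ici 0)
      (fun x _ => (hd x).continuousAt.continuousWithinAt)
      (fun x _ => (hd x).differentiableAt.differentiableWithinAt) fun x hx => ?_
    rw [interior_Ici] at hx
    rw [(hd x).deriv]
    exact mul_nonneg (le_of_lt hx) (Real.sinh_nonneg_iff.2 (le_of_lt hx))
  have := hm (Set.mem_Ici.2 le_rfl) (Set.mem_Ici.2 hy) hy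
  simp at this
  linarith

end Tanh

section DevF

variable {N : ℕ} {γ a : ℝ}

theorem devF_zero : devF N γ a 0 = 0 := by simp [devF]

/-- The slope of `-N log(1 - τ x)` is at least `N τ` on `x ≥ 0`. All monotonicity and inversion
facts about `devF` follow from this. -/
theorem le_devF_sub (hγ : 0 ≤ Real.tanh (γ / N)) {x y : ℝ} (hx : 0 ≤ x) (hxy : x ≤ y)
    (hy : Real.tanh (γ / N) * y < 1) :
    (N * Real.tanh (γ / N) - a) * (y - x) ≤ devF N γ a y - devF N γ a x := by
  set τ := Real.tanh (γ / N)
  have hy' : 0 < 1 - τ * y := by linarith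
  have hxy' : τ * x ≤ τ * y := mul_le_mul_of_nonneg_left hxy hγ
  have hx' : 0 < 1 - τ * x := by linarith
  have hx1 : 1 - τ * x ≤ 1 := by linarith [mul_nonneg hγ hx]
  have h1 : τ * (y - x) ≤ Real.log (1 - τ * x) - Real.log (1 - τ * y) := by
    rw [← Real.log_div hx'.ne' hy'.ne']
    have h2 := Real.one_sub_inv_le_log_of_pos (div_pos hx' hy')
    rw [inv_div] at h2
    refine le_trans ?_ h2
    rw [le_sub_iff_add_le, ← le_sub_iff_add_le', div_le_iff₀ hx']
    nlinarith [mul_nonneg (mul_nonneg hγ hx) (mul_nonneg hγ (sub_nonneg.2 hxy))]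
  have h3 := mul_le_mul_of_nonneg_left h1 (Nat.cast_nonneg (α := ℝ) N)
  simp only [devF]
  change _ ≤ -(N : ℝ) * Real.log (1 - τ * y) - a * y - (-(N : ℝ) * Real.log (1 - τ * x) - a * x)
  linarith

variable (hN : 0 < N) (hγ : 0 < γ) (ha : a < N * Real.tanh (γ / N)) {s : ℝ}
  (hs : 0 ≤ s)

include hN hγ ha hs

theorem exists_devF_eq : s ∈ devF N γ a '' {x | 0 ≤ x ∧ Real.tanh (γ / N) * x < 1} := by
  have hN' : (0 : ℝ) < N := by exact_mod_cast hN
  have hτ : 0 < Real.tanh (γ / N) := tanh_pos (by positivity)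
  set τ := Real.tanh (γ / N) with hτd
  -- Chosen so that the logarithmic term equals `s + N` at `x₁`; the extra `N` pays for `a * x₁ ≤
  -- N`.
  set k : ℝ := (s + N) / N with hk
  have hk0 : 0 ≤ k := by positivity
  set x₁ := (1 - Real.exp (-k)) / τ with hx₁
  have he : Real.exp (-k) ≤ 1 := Real.exp_le_one_iff.2 (by linarith)
  have hx0 : 0 ≤ x₁ := div_nonneg (by linarith) hτ.le
  have hτx : τ * x₁ = 1 - Real.exp (-k) := by rw [hx₁]; field_simp
  have hpos : ∀ x ∈ Set.Icc 0 x₁, 0 < 1 - τ * x := by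
    intro x hx
    have := mul_le_mul_of_nonneg_left hx.2 hτ.le
    have := Real.exp_pos (-k)
    linarith
  have hc : ContinuousOn (devF N γ a) (Set.Icc 0 x₁) := by
    unfold devF
    refine ContinuousOn.sub (continuousOn_const.mul (ContinuousOn.log ?_ fun x hx =>
      (hpos x hx).ne')) (by fun_prop)
    fun_prop
  have h1 : s ≤ devF N γ a x₁ := by
    simp only [devF]
    rw [← hτd, hτx]
    have e1 : -(N : ℝ) * Real.log (1 - (1 - Real.exp (-k))) = s + N := by
      rw [sub_sub_cancel, Real.log_exp, hk]
      field_simp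
    have e2 : a * x₁ ≤ N := by
      calc a * x₁ ≤ N * τ * x₁ := mul_le_mul_of_nonneg_right ha.le hx0
        _ = N * (1 - Real.exp (-k)) := by rw [mul_assoc, hτx]
        _ ≤ N * 1 := mul_le_mul_of_nonneg_left (by linarith [Real.exp_pos (-k)]) hN'.le
        _ = N := mul_one _
    linarith
  obtain ⟨x, hx, hxs⟩ := intermediate_value_Icc hx0 hc ⟨by rw [devF_zero]; exact hs, h1⟩
  exact ⟨x, ⟨hx.1, by linarith [hpos x hx]⟩, hxs⟩

theorem devFInv_nonneg : 0 ≤ devFInv N γ a s :=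
  (Function.invFunOn_mem (exists_devF_eq hN hγ ha hs)).1

theorem tanh_mul_devFInv_lt_one : Real.tanh (γ / N) * devFInv N γ a s < 1 :=
  (Function.invFunOn_mem (exists_devF_eq hN hγ ha hs)).2

theorem devF_devFInv : devF N γ a (devFInv N γ a s) = s :=
  Function.invFunOn_eq (exists_devF_eq hN hγ ha hs)

theorem mul_devFInv_le : (N * Real.tanh (γ / N) - a) * devFInv N γ a s ≤ s := by
  have hN' : (0 : ℝ) < N := by exact_mod_cast hN
  have h := le_devF_sub (a := a) (tanh_pos (by positivity : 0 < γ / N)).le le_rfl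
    (devFInv_nonneg hN hγ ha hs) (tanh_mul_devFInv_lt_one hN hγ ha hs)
  rw [devF_devFInv hN hγ ha hs, devF_zero] at h
  simpa using h

theorem le_devFInv {x : ℝ} (hx : Real.tanh (γ / N) * x < 1) (hxs : devF N γ a x ≤ s) :
    x ≤ devFInv N γ a s := by
  have hN' : (0 : ℝ) < N := by exact_mod_cast hN
  by_contra! hlt
  have h := le_devF_sub (a := a) (tanh_pos (by positivity : 0 < γ / N)).le
    (devFInv_nonneg hN hγ ha hs) hlt.le hx
  rw [devF_devFInv hN hγ ha hs] at h
  have := mul_pos (sub_pos.2 ha) (sub_pos.2 hlt)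
  linarith

end DevF

/-! ### The localized deviation inequality. -/

section Deviation

variable {Θ : Type*} [MeasurableSpace Θ]

theorem BddMeas.integral_add {g h : Θ → ℝ} (hg : BddMeas g) (hh : BddMeas h) (μ : Measure Θ)
    [IsFiniteMeasure μ] : ∫ x, (g x + h x) ∂μ = ∫ x, g x ∂μ + ∫ x, h x ∂μ :=
  MeasureTheory.integral_add (hg.integrable μ) (hh.integrable μ)

theorem BddMeas.integral_sub {g h : Θ → ℝ} (hg : BddMeas g) (hh : BddMeas h) (μ : Measure Θ)
    [IsFiniteMeasure μ] : ∫ x, (g x - h x) ∂μ = ∫ x, g x ∂μ - ∫ x, h x ∂μ :=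
  MeasureTheory.integral_sub (hg.integrable μ) (hh.integrable μ)

/-- Jensen's inequality in the second coordinate only. -/
theorem logZ_integral_le_logZ_prod {Q : Θ × Θ → ℝ} (hQ : BddMeas Q) (μ ν : Measure Θ)
    [IsProbabilityMeasure μ] [IsProbabilityMeasure ν] :
    logZ μ (fun a => ∫ b, Q (a, b) ∂ν) ≤ logZ (μ.prod ν) Q := by
  have hb := hQ.integral_prod_right ν
  refine Real.log_le_log (hb.integral_exp_pos μ) ?_
  rw [integral_prod _ (hQ.exp.integrable _)]
  refine integral_mono (hb.exp.integrable μ) ((hQ.exp.integral_prod_right ν).integrable μ) fun a => ?_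
  have h := integral_le_logZ (hQ.prod_right a) ν
  have h2 := Real.exp_le_exp.2 h
  rwa [exp_logZ (hQ.prod_right a)] at h2

theorem BddMeas.log_one_sub {α : Type*} [MeasurableSpace α] {h : α → ℝ} (hh : BddMeas h)
    (h1 : ∀ x, |h x| ≤ 1) {t : ℝ} (ht : |t| < 1) :
    BddMeas (fun x => Real.log (1 - t * h x)) := by
  refine ⟨Real.measurable_log.comp ((hh.const_mul t).1.const_sub 1),
    |Real.log (1 - |t|)| + Real.log 2, fun x => ?_⟩
  have hb : |t * h x| ≤ |t| := by
    rw [abs_mul]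
    simpa using mul_le_mul_of_nonneg_left (h1 x) (abs_nonneg t)
  have hb' := abs_le.1 hb
  have l1 : Real.log (1 - |t|) ≤ Real.log (1 - t * h x) :=
    Real.log_le_log (by linarith) (by linarith)
  have l2 : Real.log (1 - t * h x) ≤ Real.log 2 :=
    Real.log_le_log (by linarith) (by linarith)
  have := neg_abs_le (Real.log (1 - |t|))
  have := Real.log_nonneg (x := 2) (by norm_num)
  rw [abs_le]
  constructor <;> linarith [abs_nonneg (Real.log (1 - |t|))]

/-- The exponent of the relative deviation inequality. -/
noncomputable def devExp (N : ℕ) (γ : ℝ) (R r : Θ → ℝ) (M : Θ × Θ → ℝ) (q : Θ × Θ) : ℝ :=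
  -(N : ℝ) * Real.log (1 - Real.tanh (γ / N) * (R q.1 - R q.2)) - γ * (r q.1 - r q.2)
    - N * Real.log (Real.cosh (γ / N)) * M q

theorem BddMeas.comp_fst {h : Θ → ℝ} (hh : BddMeas h) : BddMeas (fun q : Θ × Θ => h q.1) :=
  ⟨hh.1.comp measurable_fst, hh.2.imp fun _ hC q => hC q.1⟩

theorem BddMeas.comp_snd {h : Θ → ℝ} (hh : BddMeas h) : BddMeas (fun q : Θ × Θ => h q.2) :=
  ⟨hh.1.comp measurable_snd, hh.2.imp fun _ hC q => hC q.2⟩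

theorem BddMeas.devExp {N : ℕ} {γ : ℝ} {R r : Θ → ℝ} {M : Θ × Θ → ℝ} (hR : BddMeas R)
    (hr : BddMeas r) (hM : BddMeas M) (hR1 : ∀ θ θ', |R θ - R θ'| ≤ 1) :
    BddMeas (devExp N γ R r M) :=
  ((((hR.comp_fst.sub hR.comp_snd).log_one_sub (fun q => hR1 q.1 q.2)
    (Real.abs_tanh_lt_one _)).const_mul _).sub ((hr.comp_fst.sub hr.comp_snd).const_mul γ)).sub
    (hM.const_mul _)

/-- The deviation inequality, localized by Gibbs measures. -/
theorem devF_sub_le {N : ℕ} {γ β l : ℝ} {R r : Θ → ℝ} {M : Θ × Θ → ℝ} (hR : BddMeas R)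
    (hr : BddMeas r) (hM : BddMeas M) (hR1 : ∀ θ θ', |R θ - R θ'| ≤ 1)
    (hMs : ∀ θ θ', M (θ, θ') = M (θ', θ)) (π : Measure Θ) [IsProbabilityMeasure π]
    (hA : logZ ((gibbs π R β).prod (gibbs π R β)) (devExp N γ R r M) ≤ l)
    {g : Θ → ℝ} (hg : BddMeas g) (b : ℝ) :
    devF N γ β (∫ θ, R θ ∂(π.tilted g) - ∫ θ, R θ ∂(gibbs π R β)) ≤
      (∫ θ, (g θ - -(b * r θ)) ∂(π.tilted g) - logZ π g + logZ π (fun θ => -(b * r θ)))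
      + (γ - b) * (∫ θ, r θ ∂(π.tilted g) - ∫ θ, r θ ∂(gibbs π R β))
      + logZ (gibbs π r b) (fun θ => N * Real.log (Real.cosh (γ / N)) *
          ∫ θ', M (θ, θ') ∂(π.tilted g)) + l := by
  have hμ := hR.gibbs β π
  have hρ := hg.isProbabilityMeasure_tilted π
  have hRβ := (hR.const_mul β).neg
  have hrb := (hr.const_mul b).neg
  set ρ := π.tilted g with hρd
  set μ := gibbs π R β with hμd
  set w := (N : ℝ) * Real.log (Real.cosh (γ / N))
  set τ := Real.tanh (γ / N) with hτ
  set y := ∫ θ, R θ ∂ρ - ∫ θ, R θ ∂μ with hy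
  have hy1 : |y| ≤ 1 := by
    have e : y = ∫ θ, ∫ θ', (R θ - R θ') ∂μ ∂ρ := by
      simp_rw [(BddMeas.const (_ : ℝ)).integral_sub hR μ]
      simp only [integral_const, probReal_univ, one_smul]
      rw [hR.integral_sub (BddMeas.const _) ρ]
      simp [hy]
    rw [e]
    have h1 : ∀ θ, ‖∫ θ', (R θ - R θ') ∂μ‖ ≤ 1 := fun θ => by
      simpa using norm_integral_le_of_norm_le_const (μ := μ) (f := fun θ' => R θ - R θ')
        (ae_of_all _ fun θ' => hR1 θ θ')
    simpa using norm_integral_le_of_norm_le_const (μ := ρ) (ae_of_all _ h1)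
  have hpos : 0 < 1 - τ * y := one_sub_tanh_mul_pos _ hy1
  -- `k` is the slope at `y` of the convex function `-N log(1 - τ x)`. Replacing that function by
  -- its tangent makes the integral over the second parameter explicit.
  set k := N * τ / (1 - τ * y) with hk
  set c₀ := -(N : ℝ) * Real.log (1 - τ * y) with hc₀
  have hQ : BddMeas (fun q : Θ × Θ => c₀ + k * ((R q.1 - R q.2) - y) - γ * (r q.1 - r q.2)
      - w * M q) :=
    (((BddMeas.const c₀).add (((hR.comp_fst.sub hR.comp_snd).sub (BddMeas.const y)).const_mul k)).sub
      ((hr.comp_fst.sub hr.comp_snd).const_mul γ)).sub (hM.const_mul w)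
  have hQle : ∀ q : Θ × Θ, c₀ + k * ((R q.1 - R q.2) - y) - γ * (r q.1 - r q.2)
      - w * M q ≤ devExp N γ R r M q := by
    intro q
    have hq : 0 < 1 - τ * (R q.1 - R q.2) := one_sub_tanh_mul_pos _ (hR1 q.1 q.2)
    have h1 := Real.log_le_sub_one_of_pos (div_pos hq hpos)
    rw [Real.log_div hq.ne' hpos.ne'] at h1
    have h2 := mul_le_mul_of_nonneg_left h1 (Nat.cast_nonneg (α := ℝ) N)
    have h3 : N * ((1 - τ * (R q.1 - R q.2)) / (1 - τ * y) - 1) =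
        -(k * ((R q.1 - R q.2) - y)) := by
      rw [hk]
      field_simp
      ring
    unfold devExp
    change _ ≤ -(N : ℝ) * Real.log (1 - τ * (R q.1 - R q.2)) - γ * (r q.1 - r q.2) - w * M q
    linarith
  clear_value c₀ k
  have hφ := hQ.integral_prod_right μ
  have h1 := (logZ_integral_le_logZ_prod hQ μ μ).trans
    ((logZ_mono hQ (hR.devExp hr hM hR1) _ hQle).trans hA)
  have hMμ := hM.integral_prod_right μ
  have hMρ := hM.integral_prod_right ρ
  have eφ : ∀ θ, ∫ θ', (c₀ + k * ((R θ - R θ') - y) - γ * (r θ - r θ') - w * M (θ, θ')) ∂μ =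
      c₀ + k * ((R θ - ∫ θ', R θ' ∂μ) - y) - γ * (r θ - ∫ θ', r θ' ∂μ)
        - w * ∫ θ', M (θ, θ') ∂μ := by
    intro θ
    have b1 := (((BddMeas.const (α := Θ) (R θ)).sub hR).sub (BddMeas.const y)).const_mul k
    have b2 := ((BddMeas.const (α := Θ) (r θ)).sub hr).const_mul γ
    rw [(((BddMeas.const c₀).add b1).sub b2).integral_sub ((hM.prod_right θ).const_mul w),
      ((BddMeas.const c₀).add b1).integral_sub b2, (BddMeas.const c₀).integral_add b1,
      integral_const_mul, integral_const_mul, integral_const_mul,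
      ((BddMeas.const (R θ)).sub hR).integral_sub (BddMeas.const y),
      (BddMeas.const (R θ)).integral_sub hR, (BddMeas.const (r θ)).integral_sub hr]
    simp
  simp only [eφ] at h1 hφ
  have h2 : logZ μ _ = _ := logZ_tilted hRβ hφ π
  -- The tangent at `g` brings in the means under `ρ`; the linear term in `k` vanishes, as `y` is
  -- the mean of `R q.1 - R q.2`.
  have h3 := logZ_add_integral_le hg (hRβ.add hφ) π
  rw [← hρd] at h3
  have e3 : ∫ θ, (-(β * R θ) + (c₀ + k * ((R θ - ∫ θ', R θ' ∂μ) - y) - γ * (r θ - ∫ θ', r θ' ∂μ)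
        - w * ∫ θ', M (θ, θ') ∂μ) - g θ) ∂ρ =
      -(β * ∫ θ, R θ ∂ρ) + (c₀ - γ * (∫ θ, r θ ∂ρ - ∫ θ', r θ' ∂μ)
        - w * ∫ θ, ∫ θ', M (θ, θ') ∂μ ∂ρ) - ∫ θ, g θ ∂ρ := by
    have b1 := ((hR.sub (BddMeas.const (∫ θ', R θ' ∂μ))).sub (BddMeas.const y)).const_mul k
    have b2 := (hr.sub (BddMeas.const (∫ θ', r θ' ∂μ))).const_mul γ
    rw [(hRβ.add hφ).integral_sub hg, hRβ.integral_add hφ, integral_neg, integral_const_mul,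
      (((BddMeas.const c₀).add b1).sub b2).integral_sub (hMμ.const_mul w),
      ((BddMeas.const c₀).add b1).integral_sub b2, (BddMeas.const c₀).integral_add b1,
      integral_const_mul, integral_const_mul, integral_const_mul,
      (hR.sub (BddMeas.const _)).integral_sub (BddMeas.const y),
      hR.integral_sub (BddMeas.const _), hr.integral_sub (BddMeas.const _)]
    simp [← hy]
  rw [e3] at h3
  have hwM := hMρ.const_mul w
  have h4 : logZ (gibbs π r b) (fun θ => w * ∫ θ', M (θ, θ') ∂ρ) = _ := logZ_tilted hrb hwM π
  -- Adding this to `h3` eliminates the log-partition function of `-β R`, leaving a divergence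
  -- relative to the observable `gibbs π r b`.
  have h5 := logZ_add_integral_le hRβ (hrb.add hwM) π
  change logZ π _ + ∫ θ, _ ∂μ ≤ _ at h5
  rw [(hrb.add hwM).integral_sub hRβ, hrb.integral_add hwM, integral_neg, integral_neg,
    integral_const_mul, integral_const_mul, integral_const_mul] at h5
  -- By symmetry of `M`, the mixed distance terms of `h3` and `h5` cancel.
  have h6 : ∫ θ, ∫ θ', M (θ, θ') ∂ρ ∂μ = ∫ θ, ∫ θ', M (θ, θ') ∂μ ∂ρ := by
    rw [integral_integral_swap (f := fun θ θ' => M (θ, θ')) (hM.integrable (μ.prod ρ))]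
    simp_rw [fun θ θ' => hMs θ θ']
  rw [h6] at h5
  have h7 : ∫ θ, (g θ - -(b * r θ)) ∂ρ = ∫ θ, g θ ∂ρ + b * ∫ θ, r θ ∂ρ := by
    rw [hg.integral_sub hrb, integral_neg, integral_const_mul]
    ring
  rw [h4, h7]
  unfold devF
  rw [← hτ, ← hc₀]
  rw [h2] at h1
  rw [hy]
  linarith

end Deviation

/-! ### Comparison of Gibbs means. -/

section GibbsComparison

variable {Θ : Type*} [MeasurableSpace Θ]

/-- Cross monotonicity of the means of two Gibbs measures. -/
theorem mul_mean_sub_le {R r : Θ → ℝ} (hR : BddMeas R) (hr : BddMeas r) (π : Measure Θ)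
    [IsProbabilityMeasure π] (a b : ℝ) :
    b * (∫ θ, r θ ∂(gibbs π r b) - ∫ θ, r θ ∂(gibbs π R a)) ≤
      a * (∫ θ, R θ ∂(gibbs π r b) - ∫ θ, R θ ∂(gibbs π R a)) := by
  have h0 := BddMeas.const (α := Θ) 0
  have h1 := logZ_lin_tangent hR hr h0 π (-a) 0 0 0 (-b) 0
  have h2 := logZ_lin_tangent hR hr h0 π 0 (-b) 0 (-a) 0 0
  rw [tilted_lin_fst] at h1
  rw [tilted_lin_snd] at h2
  linarith

theorem mean_gibbs_antitone {r : Θ → ℝ} (hr : BddMeas r) (π : Measure Θ)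
    [IsProbabilityMeasure π] {a b : ℝ} (hab : a ≤ b) :
    ∫ θ, r θ ∂(gibbs π r b) ≤ ∫ θ, r θ ∂(gibbs π r a) := by
  rcases hab.eq_or_lt with rfl | hlt
  · exact le_rfl
  · have h := mul_mean_sub_le hr hr π a b
    by_contra! hc
    nlinarith [mul_pos (sub_pos.2 hlt) (sub_pos.2 hc)]

theorem abs_mean_sub_mean_le_one {R : Θ → ℝ} (hR : BddMeas R) (hR0 : ∀ θ, 0 ≤ R θ)
    (hR1 : ∀ θ, R θ ≤ 1) (ρ μ : Measure Θ) [IsProbabilityMeasure ρ] [IsProbabilityMeasure μ] :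
    |∫ θ, R θ ∂ρ - ∫ θ, R θ ∂μ| ≤ 1 := by
  have h1 : ∀ (ν : Measure Θ) [IsProbabilityMeasure ν], ∫ θ, R θ ∂ν ≤ 1 := fun ν _ => by
    simpa using integral_mono (hR.integrable ν) (integrable_const 1) hR1
  have h0 : ∀ ν : Measure Θ, 0 ≤ ∫ θ, R θ ∂ν := fun ν => integral_nonneg hR0
  rw [abs_le]
  constructor <;> linarith [h1 ρ, h1 μ, h0 ρ, h0 μ]

end GibbsComparison

/-! ### Validity of the empirical bound on the deviation event. -/

section EmpBound

variable {X Y Θ : Type*} [MeasurableSpace X] [Finite Y] [MeasurableSpace Y]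
  [DiscreteMeasurableSpace Y] [MeasurableSpace Θ] {f : Θ → X → Y}

theorem logMoment_nonneg (hf : Measurable (Function.uncurry f)) (π : Measure Θ)
    [IsProbabilityMeasure π] {N : ℕ} (z : Fin N → X × Y) (γ l : ℝ) (ρ : Measure Θ)
    [IsProbabilityMeasure ρ] : 0 ≤ logMoment f π z γ l ρ := by
  have := (bddMeas_empRisk hf z).gibbs l π
  have hM := ((bddMeas_empDist hf z).integral_prod_right ρ).const_mul
    ((N : ℝ) * Real.log (Real.cosh (γ / N)))
  refine le_trans (integral_nonneg fun θ => ?_) (integral_le_logZ hM (gibbs π (empRisk f z) l))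
  exact mul_nonneg (mul_nonneg (Nat.cast_nonneg _) (Real.log_nonneg (Real.one_le_cosh _)))
    (integral_nonneg fun θ' => empDist_nonneg f z _ _)

variable {N : ℕ} (z : Fin N → X × Y) (P : Fin N → Measure (X × Y))
  [∀ i, IsProbabilityMeasure (P i)] (π : Measure Θ) [IsProbabilityMeasure π] {β γ L : ℝ}

/-- The deviation event on which the empirical bound is valid at `(β, γ)`. -/
def DevEvent (f : Θ → X → Y) (P : Fin N → Measure (X × Y)) (π : Measure Θ) (β γ L : ℝ)
    (z : Fin N → X × Y) : Prop :=
  logZ ((gibbs π (risk f P) β).prod (gibbs π (risk f P) β))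
    (devExp N γ (risk f P) (empRisk f z) (fun q => empDist f z q.1 q.2)) ≤ L

variable {z P π}

theorem DevEvent.devF_le (hA : DevEvent f P π β γ L z) (hf : Measurable (Function.uncurry f))
    (a b : ℝ) :
    devF N γ β (∫ θ, risk f P θ ∂(gibbs π (empRisk f z) a)
        - ∫ θ, risk f P θ ∂(gibbs π (risk f P) β)) ≤
      (InformationTheory.klDiv (gibbs π (empRisk f z) a) (gibbs π (empRisk f z) b)).toReal
      + (γ - b) * (∫ θ, empRisk f z θ ∂(gibbs π (empRisk f z) a)
        - ∫ θ, empRisk f z θ ∂(gibbs π (risk f P) β))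
      + logMoment f π z γ b (gibbs π (empRisk f z) a) + L := by
  have hr := bddMeas_empRisk hf z
  have hg := (hr.const_mul a).neg
  have hh := (hr.const_mul b).neg
  have h := devF_sub_le (bddMeas_risk hf P) hr (bddMeas_empDist hf z) (abs_risk_sub_le_one P)
    (fun θ θ' => empDist_comm f z θ θ') π hA hg b
  have hk : InformationTheory.klDiv (gibbs π (empRisk f z) a) (gibbs π (empRisk f z) b) = _ :=
    klDiv_tilted_tilted hg hh π
  rw [hk, ENNReal.toReal_ofReal (kl_tilted_nonneg hg hh π)]
  exact h

/-- This replaces the unobservable mean of `r` under the Gibbs measure at `β R`. Taking both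
temperatures equal to `b` kills the divergence, and cross monotonicity bounds `y` by `β / b * x`.
The inequality then closes on `x`, with slope parameter `β * γ / b` in place of `β`, and can be
inverted. -/
theorem DevEvent.mean_sub_le (hA : DevEvent f P π β γ L z) (hf : Measurable (Function.uncurry f))
    (hN : 0 < N) (hβ : 0 < β) (hγ : 0 < γ) (hL : 0 ≤ L) {b : ℝ} (hbγ : b ≤ γ)
    (hb : β * γ / N * (Real.tanh (γ / N))⁻¹ < b) :
    ∫ θ, empRisk f z θ ∂(gibbs π (empRisk f z) b)
        - ∫ θ, empRisk f z θ ∂(gibbs π (risk f P) β) ≤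
      β / b * devFInv N γ (β * γ / b)
        (logMoment f π z γ b (gibbs π (empRisk f z) b) + L) := by
  have hN' : (0 : ℝ) < N := by exact_mod_cast hN
  have hτ : 0 < Real.tanh (γ / N) := tanh_pos (by positivity)
  have hb0 : 0 < b := lt_trans (by positivity) hb
  have hr := bddMeas_empRisk hf z
  have hR := bddMeas_risk hf P
  have := hr.gibbs b π
  have := hR.gibbs β π
  have h1 := hA.devF_le hf b b
  have h2 := mul_mean_sub_le hR hr π β b
  have hG := logMoment_nonneg hf π z γ b (gibbs π (empRisk f z) b)
  have hx1 := abs_mean_sub_mean_le_one hR (risk_nonneg P) (risk_le_one P)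
    (gibbs π (empRisk f z) b) (gibbs π (risk f P) β)
  rw [InformationTheory.klDiv_self, ENNReal.toReal_zero, zero_add] at h1
  set x := ∫ θ, risk f P θ ∂(gibbs π (empRisk f z) b) - ∫ θ, risk f P θ ∂(gibbs π (risk f P) β)
  set y := ∫ θ, empRisk f z θ ∂(gibbs π (empRisk f z) b)
    - ∫ θ, empRisk f z θ ∂(gibbs π (risk f P) β)
  set G := logMoment f π z γ b (gibbs π (empRisk f z) b)
  have hy : y ≤ β / b * x := by
    rw [div_mul_eq_mul_div, le_div_iff₀ hb0]
    linarith
  have h3 : devF N γ (β * γ / b) x ≤ G + L := by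
    have h4 : (γ - b) * y ≤ (γ - b) * (β / b * x) :=
      mul_le_mul_of_nonneg_left hy (by linarith)
    have h5 : (γ - b) * (β / b * x) = β * γ / b * x - β * x := by
      field_simp
    simp only [devF] at h1 ⊢
    linarith
  have ha : β * γ / b < N * Real.tanh (γ / N) := by
    rw [div_lt_iff₀ hb0]
    rw [← div_eq_mul_inv, div_div, div_lt_iff₀ (by positivity)] at hb
    linarith
  have h6 := le_devFInv hN hγ ha (add_nonneg hG hL)
    (by linarith [one_sub_tanh_mul_pos (γ / N) hx1]) h3
  exact hy.trans (mul_le_mul_of_nonneg_left h6 (by positivity))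

/-- On the deviation event, a nonpositive empirical bound at `(β, γ)` compares the posterior
with the Gibbs distribution at inverse temperature `β`. -/
theorem mean_risk_le_of_empBound_nonpos (hf : Measurable (Function.uncurry f)) (hN : 0 < N)
    (ν : Measure ℝ) (ε : ℝ) (hβ : 0 < β) (hγ : 0 < γ) (hγN : γ ≤ N)
    (hL : 0 < -Real.log (ε * ν.real {β} * ν.real {γ}))
    (hA : β < γ / 2 → DevEvent f P π β γ (-Real.log (ε * ν.real {β} * ν.real {γ})) z)
    (hB : empBound f π z ν ε (gibbs π (empRisk f z) (γ / 2)) β γ ≤ 0) :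
    ∫ θ, risk f P θ ∂(gibbs π (empRisk f z) (γ / 2)) ≤
      ∫ θ, risk f P θ ∂(gibbs π (risk f P) β) := by
  have hN' : (0 : ℝ) < N := by exact_mod_cast hN
  have hγN' : 0 < γ / N := by positivity
  have hτ : 0 < Real.tanh (γ / N) := tanh_pos hγN'
  have hr := bddMeas_empRisk hf z
  have hR := bddMeas_risk hf P
  have hρ := hr.gibbs (γ / 2) π
  have hμ := hR.gibbs β π
  set L := -Real.log (ε * ν.real {β} * ν.real {γ}) with hLd
  set y := ∫ θ, risk f P θ ∂(gibbs π (empRisk f z) (γ / 2))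
    - ∫ θ, risk f P θ ∂(gibbs π (risk f P) β) with hy
  -- `V` bounds from below every term of the infimum: by `devF` when `b₂ < γ / 2`, and by `L`
  -- otherwise.
  set V : ℝ := if β < γ / 2 then min L (devF N γ β y) else L with hV
  have key : (V : EReal) ≤ empBound f π z ν ε (gibbs π (empRisk f z) (γ / 2)) β γ := by
    unfold empBound
    refine le_iInf fun b₁ => le_iInf fun hb₁ => le_iInf fun b₂ => le_iInf fun hb₂ => ?_
    have hb0 : 0 < b₂ := lt_trans (by positivity) hb₂
    -- As `tanh y ≤ y`, the constraint on `b₂` forces `β < b₂`; thus `β ≥ γ / 2` excludes `b₂ < γ /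
    -- 2`, and no deviation event is needed.
    have hβb : β < b₂ := by
      refine lt_of_le_of_lt ?_ hb₂
      rw [← div_eq_mul_inv, le_div_iff₀ hτ, mul_div_assoc]
      exact mul_le_mul_of_nonneg_left (tanh_le_self hγN'.le) hβ.le
    have ha : β * γ / b₂ < N * Real.tanh (γ / N) := by
      rw [div_lt_iff₀ hb0]
      have h := hb₂
      rw [← div_eq_mul_inv, div_div, div_lt_iff₀ (by positivity)] at h
      linarith
    have hkl : InformationTheory.klDiv (gibbs π (empRisk f z) (γ / 2))
        (gibbs π (empRisk f z) b₁) ≠ ⊤ := by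
      have : InformationTheory.klDiv (gibbs π (empRisk f z) (γ / 2))
        (gibbs π (empRisk f z) b₁) = _ :=
        klDiv_tilted_tilted (hr.const_mul (γ / 2)).neg (hr.const_mul b₁).neg π
      rw [this]
      exact ENNReal.ofReal_ne_top
    rw [← EReal.coe_ennreal_toReal hkl, ← EReal.coe_add, EReal.coe_le_coe_iff]
    have hK : 0 ≤ (InformationTheory.klDiv (gibbs π (empRisk f z) (γ / 2))
        (gibbs π (empRisk f z) b₁)).toReal := ENNReal.toReal_nonneg
    have := hr.gibbs b₂ π
    have hG1 := logMoment_nonneg hf π z γ b₁ (gibbs π (empRisk f z) (γ / 2))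
    have hG2 := logMoment_nonneg hf π z γ b₂ (gibbs π (empRisk f z) b₂)
    rw [sub_eq_add_neg _ (Real.log _), sub_eq_add_neg _ (Real.log _), ← hLd]
    have hγb : 0 ≤ γ - b₁ := by linarith [hb₁.2]
    by_cases hb : b₂ < γ / 2
    · have hβγ : β < γ / 2 := hβb.trans hb
      have hA' := hA hβγ
      have h1 := hA'.devF_le hf (γ / 2) b₁
      have h2 := hA'.mean_sub_le hf hN hβ hγ hL.le (by linarith) hb₂
      rw [hV, if_pos hβγ]
      refine (min_le_right _ _).trans (h1.trans ?_)
      have h3 := mul_le_mul_of_nonneg_left h2 hγb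
      linarith
    -- For `b₂ ≥ γ / 2` the difference of empirical means is nonnegative, so every term except `L`
    -- can be dropped.
    · have h1 := mean_gibbs_antitone hr π (not_lt.1 hb)
      have h2 := mul_nonneg hγb (sub_nonneg.2 h1)
      have h3 := devFInv_nonneg hN hγ ha (add_nonneg hG2 hL.le)
      have h4 := mul_nonneg (mul_nonneg hγb (div_nonneg hβ.le hb0.le)) h3
      have h5 : V ≤ L := by
        rw [hV]
        split_ifs
        exacts [min_le_left _ _, le_rfl]
      linarith
  have hV0 : V ≤ 0 := by exact_mod_cast key.trans hB
  by_cases hβγ : β < γ / 2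
  · rw [hV, if_pos hβγ] at hV0
    have hF : devF N γ β y ≤ 0 := by
      rcases min_le_iff.1 hV0 with h | h
      · linarith
      · exact h
    by_contra! hc
    have hy0 : 0 < y := sub_pos.2 hc
    have hy1 := abs_mean_sub_mean_le_one hR (risk_nonneg P) (risk_le_one P)
      (gibbs π (empRisk f z) (γ / 2)) (gibbs π (risk f P) β)
    -- A positive `y` would give `devF > 0`, since `β < γ / 2 ≤ N tanh(γ / N)` makes the slope
    -- positive.
    have h1 := le_devF_sub (a := β) hτ.le le_rfl hy0.le
      (by linarith [one_sub_tanh_mul_pos (γ / N) hy1])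
    rw [devF_zero] at h1
    have h2 := half_le_tanh hγN'.le ((div_le_one hN').2 hγN)
    have h3 : γ / 2 ≤ N * Real.tanh (γ / N) := by
      calc γ / 2 = N * (γ / N / 2) := by field_simp
        _ ≤ _ := mul_le_mul_of_nonneg_left h2 hN'.le
    have h4 := mul_pos (show 0 < N * Real.tanh (γ / N) - β by linarith) hy0
    linarith
  · rw [hV, if_neg hβγ] at hV0
    linarith

end EmpBound

theorem gibbs_sub_const {Θ : Type*} [MeasurableSpace Θ] (π : Measure Θ) (r : Θ → ℝ) (c v : ℝ) :
    gibbs π (fun θ => r θ - c) v = gibbs π r v := by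
  unfold gibbs
  rw [← tilted_add_const (fun θ => -(v * r θ)) (v * c) π]
  congr 1
  ext θ
  ring

/-! ### Probability of the events, and sharpness of the empirical bound. -/

section Events

variable {X Y Θ : Type*} [MeasurableSpace X] [Finite Y] [MeasurableSpace Y]
  [DiscreteMeasurableSpace Y] [MeasurableSpace Θ] {f : Θ → X → Y}

variable {N : ℕ} {z : Fin N → X × Y} {P : Fin N → Measure (X × Y)}
  [∀ i, IsProbabilityMeasure (P i)] {π : Measure Θ} [IsProbabilityMeasure π] {β γ L d : ℝ}

theorem measure_not_devEvent_le (hf : Measurable (Function.uncurry f)) (hN : 0 < N) :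
    Measure.pi P {z | ¬ DevEvent f P π β γ L z} ≤ ENNReal.ofReal (Real.exp (-L)) := by
  have hR := bddMeas_risk hf P
  have := hR.gibbs β π
  have hm : Measurable (Function.uncurry fun (z : Fin N → X × Y) (q : Θ × Θ) =>
      devExp N γ (risk f P) (empRisk f z) (fun q => empDist f z q.1 q.2) q) := by
    have h1 : Measurable fun q : (Fin N → X × Y) × (Θ × Θ) => empRisk f q.1 q.2.1 :=
      (measurable_empRisk hf N).comp
        (measurable_fst.prodMk (measurable_fst.comp measurable_snd))
    have h2 : Measurable fun q : (Fin N → X × Y) × (Θ × Θ) => empRisk f q.1 q.2.2 :=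
      (measurable_empRisk hf N).comp
        (measurable_fst.prodMk (measurable_snd.comp measurable_snd))
    have h3 := measurable_empDist hf N
    have h4 : Measurable fun q : (Fin N → X × Y) × (Θ × Θ) => risk f P q.2.1 :=
      hR.1.comp (measurable_fst.comp measurable_snd)
    have h5 : Measurable fun q : (Fin N → X × Y) × (Θ × Θ) => risk f P q.2.2 :=
      hR.1.comp (measurable_snd.comp measurable_snd)
    exact (((Real.measurable_log.comp (((h4.sub h5).const_mul _).const_sub 1)).const_mul _).sub
      ((h1.sub h2).const_mul γ)).sub (h3.const_mul _)
  have h := measure_logZ_gt_le (Measure.pi P) ((gibbs π (risk f P) β).prod (gibbs π (risk f P) β))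
    hm (fun z => hR.devExp (bddMeas_empRisk hf z) (bddMeas_empDist hf z) (abs_risk_sub_le_one P))
    (BddMeas.const 0) (fun q => by
      simpa [devExp] using lintegral_exp_relative_le_one hf hN P γ q.1 q.2) L
  simpa [DevEvent, logZ] using h

/-- The relative risk with respect to the rule of parameter `θ₀`. -/
noncomputable def relRisk (f : Θ → X → Y) (P : Fin N → Measure (X × Y)) (θ₀ θ : Θ) : ℝ :=
  risk f P θ - risk f P θ₀

/-- The relative empirical risk with respect to the rule of parameter `θ₀`. -/
noncomputable def relEmpRisk (f : Θ → X → Y) (z : Fin N → X × Y) (θ₀ θ : Θ) : ℝ :=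
  empRisk f z θ - empRisk f z θ₀

theorem bddMeas_relRisk (hf : Measurable (Function.uncurry f)) (θ₀ : Θ) :
    BddMeas (relRisk f P θ₀) :=
  (bddMeas_risk hf P).sub (BddMeas.const _)

theorem bddMeas_relEmpRisk (hf : Measurable (Function.uncurry f)) (θ₀ : Θ) :
    BddMeas (relEmpRisk f z θ₀) :=
  (bddMeas_empRisk hf z).sub (BddMeas.const _)

theorem bddMeas_empDist_left (hf : Measurable (Function.uncurry f)) (θ₀ : Θ) :
    BddMeas (fun θ => empDist f z θ θ₀) := by
  have h := (bddMeas_empDist hf z).prod_right θ₀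
  simpa only [empDist_comm f z θ₀] using h

/-- In expectation `r` becomes `R` at the price of a variance term. The hypothesis `hD` splits it
into a shift `β / 8` of the temperature and the constant `(d + L) / 8`; Markov's inequality adds
`L`. -/
theorem measure_logZ_lin_gt_le (hf : Measurable (Function.uncurry f)) (hN : 0 < N) (θ₀ : Θ)
    (hγ : 0 ≤ γ) (hγN : γ ≤ N)
    (hD : ∀ θ, 4 * (γ ^ 2 / N) * disagreement f P θ θ₀ ≤ (d + L + β * relRisk f P θ₀ θ) / 8)
    {a b u c : ℝ} (hb : |b| ≤ γ) (hu : u ≤ N * Real.log (Real.cosh (γ / N)))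
    (hc : c = a + b + β / 8) :
    Measure.pi P {z | logZ π (lin (relRisk f P θ₀) (relEmpRisk f z θ₀)
        (fun θ => empDist f z θ θ₀) c 0 0) + ((d + L) / 8 + L) <
      logZ π (lin (relRisk f P θ₀) (relEmpRisk f z θ₀) (fun θ => empDist f z θ θ₀) a b u)} ≤
      ENNReal.ofReal (Real.exp (-L)) := by
  have hR : BddMeas (relRisk f P θ₀) := bddMeas_relRisk hf θ₀
  have hm : Measurable (Function.uncurry fun (z : Fin N → X × Y) (θ : Θ) =>
      lin (relRisk f P θ₀) (relEmpRisk f z θ₀) (fun θ => empDist f z θ θ₀) a b u θ) := by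
    have h1 : Measurable fun q : (Fin N → X × Y) × Θ => empRisk f q.1 q.2 :=
      measurable_empRisk hf N
    have h2 : Measurable fun q : (Fin N → X × Y) × Θ => empRisk f q.1 θ₀ :=
      (measurable_empRisk hf N).comp (measurable_fst.prodMk measurable_const)
    have h3 : Measurable fun q : (Fin N → X × Y) × Θ => empDist f q.1 q.2 θ₀ := by
      have h := (measurable_empDist hf N).comp (f := fun q : (Fin N → X × Y) × Θ =>
        (q.1, (q.2, θ₀))) (measurable_fst.prodMk (measurable_snd.prodMk measurable_const))
      simpa only [Function.comp_def] using h
    have h4 : Measurable fun q : (Fin N → X × Y) × Θ => relRisk f P θ₀ q.2 :=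
      hR.1.comp measurable_snd
    exact ((h4.const_mul a).add ((h1.sub h2).const_mul b)).add (h3.const_mul u)
  have hh := (hR.const_mul c).add (BddMeas.const ((d + L) / 8))
  have h := measure_logZ_gt_le (Measure.pi P) π hm
    (fun z => hR.lin (bddMeas_relEmpRisk hf θ₀) (bddMeas_empDist_left hf θ₀) a b u) hh
    (fun θ => by
      have h1 := lintegral_exp_relative_le hf hN P (t := -b) hγ hγN (by rwa [abs_neg]) hu θ θ₀
      have e : ∀ z : Fin N → X × Y, ENNReal.ofReal (Real.exp (lin (relRisk f P θ₀)
          (relEmpRisk f z θ₀) (fun θ => empDist f z θ θ₀) a b u θ)) =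
          ENNReal.ofReal (Real.exp (a * relRisk f P θ₀ θ)) * ENNReal.ofReal (Real.exp
            (-(-b * (empRisk f z θ - empRisk f z θ₀)) + u * empDist f z θ θ₀)) := by
        intro z
        rw [← ENNReal.ofReal_mul (Real.exp_pos _).le, ← Real.exp_add]
        simp only [lin, relEmpRisk]
        ring_nf
      simp_rw [e]
      rw [lintegral_const_mul' _ _ ENNReal.ofReal_ne_top]
      refine (mul_le_mul_right h1 _).trans ?_
      rw [← ENNReal.ofReal_mul (Real.exp_pos _).le, ← Real.exp_add]
      refine ENNReal.ofReal_le_ofReal (Real.exp_le_exp.2 ?_)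
      have h2 := hD θ
      rw [hc]
      simp only [relRisk] at h2 ⊢
      linarith) L
  rw [logZ_add_const _ (hR.const_mul c)] at h
  have e : ∀ z : Fin N → X × Y, lin (relRisk f P θ₀) (relEmpRisk f z θ₀)
      (fun θ => empDist f z θ θ₀) c 0 0 = fun θ => c * relRisk f P θ₀ θ := by
    intro z
    ext θ
    simp [lin]
  simp_rw [e, ← add_assoc]
  exact h

theorem measure_not_localized_le (hf : Measurable (Function.uncurry f)) (hN : 0 < N) (θ₀ : Θ)
    (hγN : γ ≤ N) (hβ : 0 < β) (hβγ : 16 * β ≤ γ)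
    (hD : ∀ θ, 4 * (γ ^ 2 / N) * disagreement f P θ θ₀ ≤ (d + L + β * relRisk f P θ₀ θ) / 8) :
    Measure.pi P {z | ¬ Localized π (relRisk f P θ₀) (relEmpRisk f z θ₀)
        (fun θ => empDist f z θ θ₀) (N * Real.log (Real.cosh (γ / N))) β γ ((d + L) / 8 + L)} ≤
      7 * ENNReal.ofReal (Real.exp (-L)) := by
  have hγ : 0 < γ := by linarith
  set w := (N : ℝ) * Real.log (Real.cosh (γ / N)) with hw
  have hw0 : 0 ≤ w := mul_nonneg (Nat.cast_nonneg _) (Real.log_nonneg (Real.one_le_cosh _))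
  have hE := fun (a b u c : ℝ) (hb : |b| ≤ γ) (hu : u ≤ w) (hc : c = a + b + β / 8) =>
    measure_logZ_lin_gt_le (π := π) hf hN θ₀ hγ.le hγN hD hb hu hc
  have h1 := hE 0 (-(γ / 2)) w (-(γ / 2 - β / 8)) (by rw [abs_neg, abs_of_pos] <;> linarith)
    le_rfl (by ring)
  have h2 := hE (-(2 * (γ / 2))) (γ / 2) 0 (-(γ / 2 - β / 8)) (by rw [abs_of_pos] <;> linarith)
    hw0 (by ring)
  have h3 := hE 0 (-(4 * β)) w (-(4 * β - β / 8)) (by rw [abs_neg, abs_of_pos] <;> linarith)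
    le_rfl (by ring)
  have h4 := hE (-(2 * (4 * β))) (4 * β) 0 (-(4 * β - β / 8)) (by rw [abs_of_pos] <;> linarith)
    hw0 (by ring)
  have h5 := hE 0 (-(γ / 4)) 0 (-(γ / 4 - β / 8)) (by rw [abs_neg, abs_of_pos] <;> linarith)
    hw0 (by ring)
  have h6 := hE (-(8 * β - γ)) (-γ) 0 (-(8 * β - β / 8)) (by rw [abs_neg, abs_of_pos hγ])
    hw0 (by ring)
  have h7 := hE (-(8 * β + γ)) γ 0 (-(8 * β - β / 8)) (by rw [abs_of_pos hγ]) hw0 (by ring)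
  refine (measure_mono ?_).trans ((measure_union_le _ _).trans (le_trans (add_le_add h1
    ((measure_union_le _ _).trans (add_le_add h2 ((measure_union_le _ _).trans (add_le_add h3
    ((measure_union_le _ _).trans (add_le_add h4 ((measure_union_le _ _).trans (add_le_add h5
    ((measure_union_le _ _).trans (add_le_add h6 h7))))))))))) (le_of_eq (by ring))))
  intro z hz
  by_contra h
  simp only [Set.mem_union, not_or, Set.mem_ofPred_eq, not_lt] at h
  obtain ⟨e1, e2, e3, e4, e5, e6, e7⟩ := h
  exact hz ⟨e1, e2, e3, e4, e5, e6, e7⟩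

/-- The triangle inequality through `θ₀` separates the two parameters; each half is at most the
log-moment of the distance to `θ₀`, whence the factor 2. The function `R` enters with coefficient
zero and is arbitrary. -/
theorem logMoment_le (hf : Measurable (Function.uncurry f)) (θ₀ : Θ) (R : Θ → ℝ) (v : ℝ) :
    logMoment f π z γ v (gibbs π (empRisk f z) v) ≤
      2 * (logZ π (lin R (relEmpRisk f z θ₀) (fun θ => empDist f z θ θ₀) 0 (-v)
          (N * Real.log (Real.cosh (γ / N))))
        - logZ π (lin R (relEmpRisk f z θ₀) (fun θ => empDist f z θ θ₀) 0 (-v) 0)) := by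
  set w := (N : ℝ) * Real.log (Real.cosh (γ / N)) with hw
  have hw0 : 0 ≤ w := mul_nonneg (Nat.cast_nonneg _) (Real.log_nonneg (Real.one_le_cosh _))
  have hρ := (bddMeas_empRisk hf z).gibbs v π
  have hr : BddMeas (relEmpRisk f z θ₀) := bddMeas_relEmpRisk hf θ₀
  have hm : BddMeas (fun θ => empDist f z θ θ₀) := bddMeas_empDist_left hf θ₀
  have e1 : gibbs π (empRisk f z) v = gibbs π (relEmpRisk f z θ₀) v :=
    (gibbs_sub_const π (empRisk f z) (empRisk f z θ₀) v).symm
  have e2 : logZ (gibbs π (relEmpRisk f z θ₀) v) (fun θ => w * empDist f z θ θ₀) = _ :=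
    logZ_tilted (hr.const_mul v).neg (hm.const_mul w) π
  have e3 : (fun θ => -(v * relEmpRisk f z θ₀ θ) + w * empDist f z θ θ₀) =
      lin R (relEmpRisk f z θ₀) (fun θ => empDist f z θ θ₀) 0 (-v) w := by
    ext θ
    simp [lin]
  have e4 : (fun θ => -(v * relEmpRisk f z θ₀ θ)) =
      lin R (relEmpRisk f z θ₀) (fun θ => empDist f z θ θ₀) 0 (-v) 0 := by
    ext θ
    simp [lin]
  rw [e3, e4] at e2
  rw [← e2, ← e1]
  set ρ := gibbs π (empRisk f z) v
  have h1 := integral_le_logZ (hm.const_mul w) ρ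
  have hM := ((bddMeas_empDist hf z).integral_prod_right ρ).const_mul w
  have h2 : logMoment f π z γ v ρ ≤
      logZ ρ (fun θ => w * empDist f z θ θ₀ + ∫ θ', w * empDist f z θ' θ₀ ∂ρ) := by
    refine logZ_mono hM ((hm.const_mul w).add (BddMeas.const _)) ρ fun θ => ?_
    rw [integral_const_mul, ← mul_add]
    refine mul_le_mul_of_nonneg_left ?_ hw0
    have h3 : ∫ θ', empDist f z θ θ' ∂ρ ≤ ∫ θ', (empDist f z θ θ₀ + empDist f z θ' θ₀) ∂ρ :=
      integral_mono (((bddMeas_empDist hf z).prod_right θ).integrable ρ)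
        (((BddMeas.const _).add hm).integrable ρ) fun θ' => empDist_triangle f z θ θ' θ₀
    rw [(BddMeas.const _).integral_add hm] at h3
    simpa using h3
  rw [logZ_add_const _ (hm.const_mul w)] at h2
  linarith

/-- When the log-partition functions are localized, the empirical bound is nonpositive. -/
theorem Localized.empBound_nonpos {θ₀ : Θ}
    (hL : Localized π (relRisk f P θ₀) (relEmpRisk f z θ₀)
        (fun θ => empDist f z θ θ₀) (N * Real.log (Real.cosh (γ / N))) β γ ((d + L) / 8 + L))
    (hf : Measurable (Function.uncurry f)) (hN : 0 < N) (hγN : γ ≤ N) (hβ : 0 < β)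
    (hd : 0 < d) (hL0 : 0 ≤ L) (hβγ : 512 * β * (d + L) ≤ γ * d)
    (hR0 : ∀ θ, 0 ≤ relRisk f P θ₀ θ)
    (hup : ∀ s, β ≤ s → s * ∫ θ, relRisk f P θ₀ θ ∂(gibbs π (relRisk f P θ₀) s) ≤ 2 * d)
    (hlo : ∀ s, β ≤ s → d / 2 ≤ s * ∫ θ, relRisk f P θ₀ θ ∂(gibbs π (relRisk f P θ₀) s))
    (ν : Measure ℝ) (ε : ℝ) (hLε : L = -Real.log (ε * ν.real {β} * ν.real {γ})) :
    empBound f π z ν ε (gibbs π (empRisk f z) (γ / 2)) β γ ≤ 0 := by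
  have hN' : (0 : ℝ) < N := by exact_mod_cast hN
  have h16 : 16 * β ≤ γ := by
    have h1 : 512 * β * d ≤ γ * d := by nlinarith [mul_nonneg hβ.le hL0]
    have h2 := le_of_mul_le_mul_right h1 hd
    linarith
  have hγ : 0 < γ := by linarith
  have hR : BddMeas (relRisk f P θ₀) := bddMeas_relRisk hf θ₀
  have hr : BddMeas (relEmpRisk f z θ₀) := bddMeas_relEmpRisk hf θ₀
  have hm : BddMeas (fun θ => empDist f z θ θ₀) := bddMeas_empDist_left hf θ₀
  have a1 := hL.mean_half_le hR hr hm hR0 hup hd hβ h16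
  have a2 := hL.le_mean_four hR hr hm hR0 hup hlo hd hβ h16
  have a3 := logZ_dist_sub_le hR hr hm π hR0 hup hβ (v := γ / 2) (by linarith)
    hL.half_dist hL.half
  have a4 := logZ_dist_sub_le hR hr hm π hR0 hup hβ (v := 4 * β) le_rfl
    hL.four_dist hL.four
  have g1 := logMoment_le (π := π) (z := z) (γ := γ) hf θ₀ (relRisk f P θ₀) (γ / 2)
  have g2 := logMoment_le (π := π) (z := z) (γ := γ) hf θ₀ (relRisk f P θ₀) (4 * β)
  have e1 : ∀ v, ∫ θ, relEmpRisk f z θ₀ θ ∂(gibbs π (relEmpRisk f z θ₀) v) =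
      ∫ θ, empRisk f z θ ∂(gibbs π (empRisk f z) v) - empRisk f z θ₀ := by
    intro v
    have := (bddMeas_empRisk hf z).gibbs v π
    have e : gibbs π (relEmpRisk f z θ₀) v = gibbs π (empRisk f z) v :=
      gibbs_sub_const π (empRisk f z) (empRisk f z θ₀) v
    rw [e]
    unfold relEmpRisk
    rw [(bddMeas_empRisk hf z).integral_sub (BddMeas.const _)]
    simp
  rw [e1] at a1 a2
  have hρ := (bddMeas_empRisk hf z).gibbs (γ / 2) π
  have hρ' := (bddMeas_empRisk hf z).gibbs (4 * β) π
  have hG := logMoment_nonneg hf π z γ (4 * β) (gibbs π (empRisk f z) (4 * β))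
  have hτ := half_le_tanh (div_nonneg hγ.le hN'.le) ((div_le_one hN').2 hγN)
  have hNτ : γ / 2 ≤ N * Real.tanh (γ / N) := by
    calc γ / 2 = N * (γ / N / 2) := by field_simp
      _ ≤ _ := mul_le_mul_of_nonneg_left hτ hN'.le
  have hadm : β * γ / N * (Real.tanh (γ / N))⁻¹ < 4 * β := by
    rw [← div_eq_mul_inv, div_div, div_lt_iff₀ (by linarith)]
    nlinarith
  have ha : β * γ / (4 * β) = γ / 4 := by field_simp
  unfold empBound
  have hadm' : 0 ≤ γ / 2 ∧ γ / 2 ≤ γ := ⟨by linarith, by linarith⟩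
  -- The choice `λ₁ = γ / 2` makes the divergence vanish, and `λ₂ = 4 * β` makes the slope parameter
  -- `γ / 4`, below `γ / 2 ≤ N tanh(γ / N)`.
  refine (iInf₂_le_of_le (γ / 2) hadm' (iInf₂_le_of_le (4 * β) hadm le_rfl)).trans ?_
  rw [InformationTheory.klDiv_self, EReal.coe_ennreal_zero, zero_add, ← EReal.coe_zero,
    EReal.coe_le_coe_iff, sub_eq_add_neg _ (Real.log _), sub_eq_add_neg _ (Real.log _), ← hLε, ha]
  set G₁ := logMoment f π z γ (γ / 2) (gibbs π (empRisk f z) (γ / 2))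
  set G₂ := logMoment f π z γ (4 * β) (gibbs π (empRisk f z) (4 * β))
  have haN : γ / 4 < N * Real.tanh (γ / N) := by linarith
  have hF0 := devFInv_nonneg hN hγ haN (add_nonneg hG hL0)
  have hF := mul_devFInv_le hN hγ haN (add_nonneg hG hL0)
  set F := devFInv N γ (γ / 4) (G₂ + L)
  have hF' : γ / 4 * F ≤ G₂ + L :=
    le_trans (mul_le_mul_of_nonneg_right (by linarith) hF0) hF
  have hlast : (γ - γ / 2) * (β / (4 * β)) * F = γ / 4 * F / 2 := by
    field_simp
    ring
  -- Here `512 = 16 * 32` is used: half of this gain, `16 * (d + L)`, outweighs all the positive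
  -- terms, which add up to less than `8 * d + 16 * L`.
  have hbig : 32 * (d + L) ≤ γ * (d / (16 * β)) := by
    rw [mul_div_assoc', le_div_iff₀ (by positivity)]
    linarith
  rw [hlast]
  linarith

end Events

/-! ### The dyadic grid and the selection rule. -/

section Grid

theorem mem_grid_two {N : ℕ} (hN : 0 < N) {x : ℝ} :
    x ∈ grid 2 N ↔ ∃ k : ℕ, (2 : ℝ) ^ k < N ∧ (2 : ℝ) ^ k = x := by
  have hN' : (0 : ℝ) < N := by exact_mod_cast hN
  have h2 : 0 < Real.log 2 := Real.log_pos (by norm_num)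
  simp only [grid, Finset.mem_image, Finset.mem_range, Nat.lt_ceil]
  refine exists_congr fun k => and_congr_left fun _ => ?_
  rw [lt_div_iff₀ h2, ← Real.log_pow, Real.log_lt_log_iff (by positivity) hN']

theorem card_grid_two (N : ℕ) : (grid 2 N).card = ⌈Real.log N / Real.log 2⌉₊ := by
  unfold grid
  rw [Finset.card_image_of_injective _ (pow_right_injective₀ (by norm_num) (by norm_num)),
    Finset.card_range]

theorem uniformOn_grid_real_singleton {N : ℕ} {x : ℝ} (hx : x ∈ grid 2 N) :
    (uniformOn (grid 2 N : Set ℝ)).real {x} = 1 / ((grid 2 N).card : ℝ) := by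
  have h := uniformOn_apply_finset (s := grid 2 N) (t := {x})
  rw [Finset.inter_singleton_of_mem hx] at h
  rw [measureReal_def]
  simp only [Finset.coe_singleton, Finset.card_singleton, Nat.cast_one] at h
  rw [h]
  simp

theorem exists_empBound_nonpos_of_mem_gammaArgmax {X Y Θ : Type*} [MeasurableSpace Θ]
    {f : Θ → X → Y} {N : ℕ} {π : Measure Θ} {β γ ε : ℝ} {z : Fin N → X × Y} {γ' : ℝ}
    (hβ : β ∈ grid 2 N) (hγ : γ ∈ grid 2 N)
    (hB : empBound f π z (uniformOn (grid 2 N : Set ℝ)) ε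
      (gibbs π (empRisk f z) (γ / 2)) β γ ≤ 0) (hγ' : γ' ∈ gammaArgmax f π ε z) :
    ∃ β' ∈ grid 2 N, β ≤ β' ∧ empBound f π z (uniformOn (grid 2 N : Set ℝ)) ε
      (gibbs π (empRisk f z) (γ' / 2)) β' γ' ≤ 0 := by
  have h1 : (β : WithBot ℝ) ≤ betaMax f π ε z γ :=
    Finset.le_max (Finset.mem_filter.2 ⟨hβ, hB⟩)
  have h2 := h1.trans (hγ'.2 γ hγ)
  cases hb : betaMax f π ε z γ' with
  | bot =>
    rw [hb] at h2
    exact absurd h2 (by simp)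
  | coe b =>
    rw [hb] at h2
    have h3 := Finset.mem_filter.1 (Finset.mem_of_max hb)
    exact ⟨b, h3.1, WithBot.coe_le_coe.1 h2, h3.2⟩

/-- The diagonal pairs are excluded by the filter, and there are at least seven of them: exactly the
budget needed for the seven localization inequalities. -/
theorem card_filter_add_seven_le {N : ℕ} (hN : 0 < N) (h7 : 7 ≤ (grid 2 N).card) :
    ((grid 2 N ×ˢ grid 2 N).filter (fun q : ℝ × ℝ => q.1 < q.2 / 2)).card + 7 ≤
      (grid 2 N).card ^ 2 := by
  have h1 := Finset.card_filter_add_card_filter_not (s := grid 2 N ×ˢ grid 2 N)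
    (fun q : ℝ × ℝ => q.1 < q.2 / 2)
  rw [Finset.card_product] at h1
  have h2 : (grid 2 N).card ≤
      ((grid 2 N ×ˢ grid 2 N).filter (fun q : ℝ × ℝ => ¬ q.1 < q.2 / 2)).card := by
    refine Finset.card_le_card_of_injOn (fun x => (x, x)) (fun x hx => ?_)
      (fun x _ y _ h => (Prod.mk.inj h).1)
    obtain ⟨k, -, rfl⟩ := (mem_grid_two hN).1 hx
    have : (0 : ℝ) < 2 ^ k := by positivity
    simp only [Finset.coe_filter, Finset.mem_product, Set.mem_ofPred_eq]
    exact ⟨⟨hx, hx⟩, by linarith⟩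
  nlinarith

end Grid

/-! ### Union bound and performance of the selected temperature. -/

section Selection

variable {X Y Θ : Type*} [MeasurableSpace X] [Finite Y] [MeasurableSpace Y]
  [DiscreteMeasurableSpace Y] [MeasurableSpace Θ] {f : Θ → X → Y}

variable {N : ℕ} {P : Fin N → Measure (X × Y)}
  [∀ i, IsProbabilityMeasure (P i)] {π : Measure Θ} [IsProbabilityMeasure π] {β γ d ε : ℝ}

/-- Nonasymptotic performance of the selected temperature. -/
theorem measure_selection_le (hf : Measurable (Function.uncurry f)) (hN : 0 < N)
    (h7 : 7 ≤ (grid 2 N).card) (hε : 0 < ε) (hε1 : ε < 1) (θ₀ : Θ) {L : ℝ}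
    (hL : L = Real.log (((grid 2 N).card : ℝ) ^ 2 / ε))
    (hβ : β ∈ grid 2 N) (hγ : γ ∈ grid 2 N) (hd : 0 < d) (hβγ : 512 * β * (d + L) ≤ γ * d)
    (hR0 : ∀ θ, 0 ≤ relRisk f P θ₀ θ)
    (hup : ∀ s, β ≤ s → s * ∫ θ, relRisk f P θ₀ θ ∂(gibbs π (relRisk f P θ₀) s) ≤ 2 * d)
    (hlo : ∀ s, β ≤ s → d / 2 ≤ s * ∫ θ, relRisk f P θ₀ θ ∂(gibbs π (relRisk f P θ₀) s))
    (hD : ∀ θ, 4 * (γ ^ 2 / N) * disagreement f P θ θ₀ ≤ (d + L + β * relRisk f P θ₀ θ) / 8)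
    {γhat : (Fin N → X × Y) → ℝ} (hγhat : ∀ z, γhat z ∈ gammaArgmax f π ε z) :
    Measure.pi P {z | ¬ ∃ β' ∈ grid 2 N, β ≤ β' ∧
      ∫ θ, risk f P θ ∂(gibbs π (empRisk f z) (γhat z / 2)) ≤
        ∫ θ, risk f P θ ∂(gibbs π (risk f P) β')} ≤ ENNReal.ofReal ε := by
  set n := (grid 2 N).card with hn
  have hn7 : (7 : ℝ) ≤ n := by exact_mod_cast h7
  have hgrid : ∀ x ∈ grid 2 N, 0 < x ∧ x ≤ N := fun x hx => by
    obtain ⟨k, hk, rfl⟩ := (mem_grid_two hN).1 hx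
    exact ⟨by positivity, hk.le⟩
  have hexp : Real.exp (-L) = ε / (n : ℝ) ^ 2 := by
    rw [hL, Real.exp_neg, Real.exp_log (by positivity), inv_div]
  have hLpos : 0 < L := by
    rw [hL]
    refine Real.log_pos ?_
    rw [one_lt_div hε]
    nlinarith
  have hLε : ∀ b ∈ grid 2 N, ∀ g ∈ grid 2 N,
      L = -Real.log (ε * (uniformOn (grid 2 N : Set ℝ)).real {b} *
        (uniformOn (grid 2 N : Set ℝ)).real {g}) := by
    intro b hb g hg
    rw [uniformOn_grid_real_singleton hb, uniformOn_grid_real_singleton hg, hL, ← Real.log_inv,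
      ← hn]
    congr 1
    field_simp
  set S := (grid 2 N ×ˢ grid 2 N).filter (fun q : ℝ × ℝ => q.1 < q.2 / 2) with hS
  have hβ0 := (hgrid β hβ).1
  have h16 : 16 * β ≤ γ := by
    have h1 : 512 * β * d ≤ γ * d := by nlinarith [mul_nonneg hβ0.le hLpos.le]
    linarith [le_of_mul_le_mul_right h1 hd]
  -- Localization is needed only at `(β, γ)`, but deviation is needed at all pairs, since the
  -- selected one is random.
  have hsub : {z | ¬ ∃ β' ∈ grid 2 N, β ≤ β' ∧
      ∫ θ, risk f P θ ∂(gibbs π (empRisk f z) (γhat z / 2)) ≤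
        ∫ θ, risk f P θ ∂(gibbs π (risk f P) β')} ⊆
      (⋃ q ∈ S, {z | ¬ DevEvent f P π q.1 q.2 L z}) ∪
      {z | ¬ Localized π (relRisk f P θ₀) (relEmpRisk f z θ₀) (fun θ => empDist f z θ θ₀)
        (N * Real.log (Real.cosh (γ / N))) β γ ((d + L) / 8 + L)} := by
    intro z hz
    by_contra hc
    simp only [Set.mem_union, Set.mem_iUnion, Set.mem_ofPred_eq, not_or, not_exists,
      not_not] at hc
    obtain ⟨hc1, hc2⟩ := hc
    have hB := hc2.empBound_nonpos hf hN (hgrid γ hγ).2 hβ0 hd hLpos.le hβγ hR0 hup hlo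
      _ ε (hLε β hβ γ hγ)
    obtain ⟨β', hβ', hle, hB'⟩ := exists_empBound_nonpos_of_mem_gammaArgmax hβ hγ hB (hγhat z)
    have hγ' : γhat z ∈ grid 2 N := (hγhat z).1
    have hl := hLε β' hβ' _ hγ'
    refine hz ⟨β', hβ', hle, mean_risk_le_of_empBound_nonpos hf hN _ ε (hgrid β' hβ').1
      (hgrid _ hγ').1 (hgrid _ hγ').2 (hl ▸ hLpos) (fun hlt => ?_) hB'⟩
    rw [← hl]
    exact hc1 (β', γhat z) (Finset.mem_filter.2 ⟨Finset.mem_product.2 ⟨hβ', hγ'⟩, hlt⟩)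
  have hcard : (S.card : ℝ) + 7 ≤ (n : ℝ) ^ 2 := by
    exact_mod_cast card_filter_add_seven_le hN h7
  calc _ ≤ _ := measure_mono hsub
    _ ≤ _ := measure_union_le _ _
    _ ≤ ∑ q ∈ S, Measure.pi P {z | ¬ DevEvent f P π q.1 q.2 L z} +
        7 * ENNReal.ofReal (Real.exp (-L)) :=
      add_le_add (measure_biUnion_finset_le _ _)
        (measure_not_localized_le hf hN θ₀ (hgrid γ hγ).2 hβ0 h16 hD)
    _ ≤ ∑ q ∈ S, ENNReal.ofReal (Real.exp (-L)) + 7 * ENNReal.ofReal (Real.exp (-L)) :=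
      add_le_add_left (Finset.sum_le_sum fun q _ => measure_not_devEvent_le hf hN) _
    _ = ENNReal.ofReal ((S.card + 7) * Real.exp (-L)) := by
      rw [Finset.sum_const, nsmul_eq_mul, ← add_mul, ENNReal.ofReal_mul (by positivity),
        ENNReal.ofReal_add (by positivity) (by norm_num)]
      simp
    _ ≤ ENNReal.ofReal ε := by
      refine ENNReal.ofReal_le_ofReal ?_
      calc _ ≤ (n : ℝ) ^ 2 * Real.exp (-L) :=
            mul_le_mul_of_nonneg_right hcard (Real.exp_pos _).le
        _ = ε := by rw [hexp]; field_simp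

end Selection

/-! ### Critical temperature and rate under the margin assumption. -/

section Rates

theorem exists_two_pow_mem_Ioc {x : ℝ} (hx : 1 ≤ x) :
    ∃ k : ℕ, x / 2 < 2 ^ k ∧ (2 : ℝ) ^ k ≤ x := by
  obtain ⟨k, h1, h2⟩ := exists_nat_pow_near hx (by norm_num : (1 : ℝ) < 2)
  exact ⟨k, by rw [pow_succ] at h2; linarith, h1⟩

theorem rpow_le_one_add {y s : ℝ} (hy : 0 ≤ y) (hs : 0 ≤ s) (hs1 : s ≤ 1) : y ^ s ≤ 1 + y := by
  rcases le_total y 1 with h | h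
  · linarith [Real.rpow_le_one hy h hs]
  · calc y ^ s ≤ y ^ (1 : ℝ) := Real.rpow_le_rpow_of_exponent_le h hs1
      _ ≤ 1 + y := by rw [Real.rpow_one]; linarith

/-- The critical inverse temperature. -/
noncomputable def critTemp (c κ d M N : ℝ) : ℝ :=
  (N * d / (128 * M ^ 2)) ^ (κ / (2 * κ - 1)) * (c / d) ^ (1 / (2 * κ - 1))

variable {c κ d M N : ℝ}

theorem critTemp_pos (hc : 0 < c) (hd : 0 < d) (hM : 0 < M) (hN : 0 < N) :
    0 < critTemp c κ d M N :=
  mul_pos (Real.rpow_pos_of_pos (by positivity) _) (Real.rpow_pos_of_pos (by positivity) _)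

/-- The equation that defines the critical temperature. With `γ = 2 * M * β` it equates `4 * γ ^ 2 /
N` to `d / 8` times `(c * β / d) ^ (1 / κ)`, whence `128 = 4 * 4 * 8`. -/
theorem critTemp_rpow (hc : 0 < c) (hκ : 1 < κ) (hd : 0 < d) (hM : 0 < M) (hN : 0 < N) :
    critTemp c κ d M N ^ (2 - 1 / κ) = N * d / (128 * M ^ 2) * (c / d) ^ (1 / κ) := by
  have h1 : (0 : ℝ) < 2 * κ - 1 := by linarith
  have h2 : (0 : ℝ) < κ := by linarith
  have hA : 0 ≤ N * d / (128 * M ^ 2) := by positivity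
  have hB : 0 ≤ c / d := by positivity
  have e1 : κ / (2 * κ - 1) * (2 - 1 / κ) = 1 := by
    field_simp
    exact div_self (by linarith)
  have e2 : 1 / (2 * κ - 1) * (2 - 1 / κ) = 1 / κ := by field_simp
  rw [critTemp, Real.mul_rpow (Real.rpow_nonneg hA _) (Real.rpow_nonneg hB _), ← Real.rpow_mul hA,
    ← Real.rpow_mul hB, e1, e2, Real.rpow_one]

theorem sq_mul_rpow_le {β : ℝ} (hc : 0 < c) (hκ : 1 < κ) (hd : 0 < d) (hM : 0 < M) (hN : 0 < N)
    (hβ : 0 < β) (hle : β ≤ critTemp c κ d M N) :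
    β ^ 2 ≤ N * d / (128 * M ^ 2) * (c / d) ^ (1 / κ) * β ^ (1 / κ) := by
  have h2 : (0 : ℝ) < κ := by linarith
  have hs : 1 / κ ≤ 1 := by rw [div_le_one h2]; exact hκ.le
  rw [← critTemp_rpow hc hκ hd hM hN]
  calc β ^ 2 = β ^ (2 - 1 / κ) * β ^ (1 / κ) := by
        rw [← Real.rpow_add hβ, ← Real.rpow_two]
        ring_nf
    _ ≤ _ := by
        refine mul_le_mul_of_nonneg_right ?_ (Real.rpow_nonneg hβ.le _)
        exact Real.rpow_le_rpow hβ.le hle (by linarith)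

/-- Here `128 * 512 ^ 2 = 2 ^ 25` and the exponent `κ / (2 * κ - 1)` is at most 1; the factor 4
allows for `2 * d` and for rounding to a power of two. -/
theorem rate_mul_critTemp {L₀ : ℝ} (hc : 0 < c) (hκ : 1 < κ) (hd : 0 < d) (hM : 0 < M)
    (hN : 0 < N) (hL₀ : 1 ≤ L₀) (hML : M ≤ 512 * L₀) :
    4 * d ≤ 2 ^ 27 * c ^ (-(1 / (2 * κ - 1))) * L₀ ^ (2 * κ / (2 * κ - 1))
      * (d / N) ^ (κ / (2 * κ - 1)) * critTemp c κ d M N := by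
  have h1 : (0 : ℝ) < 2 * κ - 1 := by linarith
  set p := κ / (2 * κ - 1) with hp
  set q := 1 / (2 * κ - 1) with hq
  have hpq : 2 * p - q = 1 := by rw [hp, hq]; field_simp
  have hp0 : 0 ≤ p := by rw [hp]; exact div_nonneg (by linarith) h1.le
  have hp1 : p ≤ 1 := by rw [hp, div_le_one h1]; linarith
  have e2p : 2 * κ / (2 * κ - 1) = 2 * p := by rw [hp]; ring
  have hL0 : 0 < L₀ := by linarith
  have hK : (128 * M ^ 2) ^ p ≤ 2 ^ 25 * L₀ ^ (2 * p) := by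
    calc (128 * M ^ 2) ^ p ≤ (2 ^ 25 * L₀ ^ 2) ^ p := by
          refine Real.rpow_le_rpow (by positivity) ?_ hp0
          nlinarith
      _ = (2 ^ 25 : ℝ) ^ p * L₀ ^ (2 * p) := by
          rw [Real.mul_rpow (by positivity) (by positivity), ← Real.rpow_natCast L₀ 2,
            ← Real.rpow_mul hL0.le]
          norm_num
      _ ≤ (2 ^ 25 : ℝ) ^ (1 : ℝ) * L₀ ^ (2 * p) := by
          refine mul_le_mul_of_nonneg_right ?_ (Real.rpow_nonneg hL0.le _)
          exact Real.rpow_le_rpow_of_exponent_le (by norm_num) hp1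
      _ = _ := by rw [Real.rpow_one]
  have hKpos : 0 < (128 * M ^ 2) ^ p := Real.rpow_pos_of_pos (by positivity) _
  have e : c ^ (-q) * (d / N) ^ p * critTemp c κ d M N = d / (128 * M ^ 2) ^ p := by
    unfold critTemp
    rw [← hp, ← hq, Real.rpow_neg hc.le, Real.div_rpow hd.le hN.le, Real.div_rpow (by positivity)
      (by positivity), Real.mul_rpow hN.le hd.le, Real.div_rpow hc.le hd.le]
    have hcq := (Real.rpow_pos_of_pos hc q).ne'
    have hdq := (Real.rpow_pos_of_pos hd q).ne'
    have hNp := (Real.rpow_pos_of_pos hN p).ne'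
    have hdd : d ^ p * d ^ p = d * d ^ q := by
      rw [← Real.rpow_add hd, ← Real.rpow_one_add' hd.le]
      · congr 1; linarith
      · have : 0 < q := by rw [hq]; positivity
        linarith
    field_simp
    rw [sq, hdd]
    ring
  calc 4 * d = 4 * (d / (128 * M ^ 2) ^ p) * (128 * M ^ 2) ^ p := by field_simp
    _ ≤ 4 * (d / (128 * M ^ 2) ^ p) * (2 ^ 25 * L₀ ^ (2 * p)) :=
        mul_le_mul_of_nonneg_left hK (by positivity)
    _ = _ := by
        rw [← e, e2p]
        ring

/-- Below the critical temperature the margin assumption controls the variance term. -/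
theorem variance_le_of_le_critTemp {β γ D x : ℝ} (hc : 0 < c) (hκ : 1 < κ) (hd : 0 < d)
    (hM : 0 < M) (hN : 0 < N) (hβ : 0 < β) (hle : β ≤ critTemp c κ d M N) (hγ : 0 ≤ γ)
    (hγM : γ ≤ 2 * (M * β)) (hD : 0 ≤ D) (hx : 0 ≤ x) (hDx : c * D ^ κ ≤ x) :
    4 * (γ ^ 2 / N) * D ≤ (d + β * x) / 8 := by
  have h2 : (0 : ℝ) < κ := by linarith
  have hs0 : 0 ≤ 1 / κ := by positivity
  have hs : 1 / κ ≤ 1 := by rw [div_le_one h2]; exact hκ.le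
  have hβs := Real.rpow_pos_of_pos hβ (1 / κ)
  have hcd := Real.rpow_pos_of_pos (div_pos hc hd) (1 / κ)
  -- The margin bounds `D` by `(x / c) ^ (1 / κ)`, and `y ^ (1 / κ) ≤ 1 + y` makes this affine in
  -- `x`.
  have h3 : (c / d) ^ (1 / κ) * β ^ (1 / κ) * D ≤ 1 + β * x / d := by
    have h4 : D = (D ^ κ) ^ (1 / κ) := by
      rw [← Real.rpow_mul hD, mul_one_div_cancel h2.ne', Real.rpow_one]
    calc (c / d) ^ (1 / κ) * β ^ (1 / κ) * D
        = (c / d) ^ (1 / κ) * β ^ (1 / κ) * (D ^ κ) ^ (1 / κ) := by rw [← h4]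
      _ = (c / d * β * D ^ κ) ^ (1 / κ) := by
          rw [Real.mul_rpow (by positivity) (Real.rpow_nonneg hD _),
            Real.mul_rpow (by positivity) hβ.le]
      _ ≤ (β * x / d) ^ (1 / κ) := by
          have := Real.rpow_nonneg hD κ
          refine Real.rpow_le_rpow (by positivity) ?_ hs0
          rw [div_mul_eq_mul_div, div_mul_eq_mul_div, div_le_div_iff_of_pos_right hd]
          nlinarith
      _ ≤ 1 + β * x / d := rpow_le_one_add (by positivity) hs0 hs
  have h5 := sq_mul_rpow_le hc hκ hd hM hN hβ hle
  have h6 : γ ^ 2 ≤ 4 * M ^ 2 * β ^ 2 := by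
    calc γ ^ 2 ≤ (2 * (M * β)) ^ 2 := pow_le_pow_left₀ hγ hγM 2
      _ = _ := by ring
  have h7 : γ ^ 2 / N ≤ d / 32 * ((c / d) ^ (1 / κ) * β ^ (1 / κ)) := by
    rw [div_le_iff₀ hN]
    calc γ ^ 2 ≤ 4 * M ^ 2 * β ^ 2 := h6
      _ ≤ 4 * M ^ 2 * (N * d / (128 * M ^ 2) * (c / d) ^ (1 / κ) * β ^ (1 / κ)) :=
          mul_le_mul_of_nonneg_left h5 (by positivity)
      _ = _ := by field_simp; norm_num
  calc 4 * (γ ^ 2 / N) * D ≤ 4 * (d / 32 * ((c / d) ^ (1 / κ) * β ^ (1 / κ))) * D := by gcongr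
    _ = d / 8 * ((c / d) ^ (1 / κ) * β ^ (1 / κ) * D) := by ring
    _ ≤ d / 8 * (1 + β * x / d) := mul_le_mul_of_nonneg_left h3 (by positivity)
    _ = _ := by field_simp

/-- Keeps `γ` inside the grid. If `g = 2 * M * β` were at least `N`, then `g ^ (2 - 1 / κ)` would
exceed its bound, which is linear in `N`. -/
theorem lt_of_le_critTemp {β : ℝ} (hc : 0 < c) (hκ : 1 < κ) (hd : 0 < d)
    (hM : 1 ≤ M) (hN : 0 < N) (hβ : 0 < β) (hle : β ≤ critTemp c κ d M N)
    (hNC : d / 32 * (c / d) ^ (1 / κ) < N ^ (1 - 1 / κ)) : 2 * (M * β) < N := by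
  have h2 : (0 : ℝ) < κ := by linarith
  have hs0 : 0 ≤ 1 / κ := by positivity
  have hs : 1 / κ ≤ 1 := by rw [div_le_one h2]; exact hκ.le
  have hM0 : 0 < M := by linarith
  by_contra! hg
  set g := 2 * (M * β) with hgd
  have hg0 : 0 < g := by positivity
  have hβg : β ≤ g := by rw [hgd]; nlinarith
  have h5 := sq_mul_rpow_le hc hκ hd hM0 hN hβ hle
  have h6 : g ^ 2 ≤ N * (d / 32 * (c / d) ^ (1 / κ)) * g ^ (1 / κ) := by
    calc g ^ 2 = 4 * M ^ 2 * β ^ 2 := by rw [hgd]; ring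
      _ ≤ 4 * M ^ 2 * (N * d / (128 * M ^ 2) * (c / d) ^ (1 / κ) * β ^ (1 / κ)) :=
          mul_le_mul_of_nonneg_left h5 (by positivity)
      _ = N * (d / 32 * (c / d) ^ (1 / κ)) * β ^ (1 / κ) := by field_simp; norm_num
      _ ≤ _ := by gcongr
  have h7 : g ^ 2 = g * g ^ (1 - 1 / κ) * g ^ (1 / κ) := by
    rw [mul_assoc, ← Real.rpow_add hg0, sub_add_cancel, Real.rpow_one, sq]
  rw [h7] at h6
  have h8 := le_of_mul_le_mul_right h6 (Real.rpow_pos_of_pos hg0 _)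
  have h9 : N ^ (1 - 1 / κ) ≤ g ^ (1 - 1 / κ) := Real.rpow_le_rpow hN.le hg (by linarith)
  have h10 : N * (d / 32 * (c / d) ^ (1 / κ)) < N * N ^ (1 - 1 / κ) := mul_lt_mul_of_pos_left hNC hN
  have h11 : N * N ^ (1 - 1 / κ) ≤ g * g ^ (1 - 1 / κ) :=
    mul_le_mul hg h9 (Real.rpow_nonneg hN.le _) hg0.le
  linarith

/-- A nontrivial rate limits the confidence term: `L₀ ^ 2 = O(N)`. This keeps the sample-size
threshold independent of `ε`. -/
theorem sq_le_of_rate_le_one {L₀ : ℝ} (hc : 0 < c) (hκ : 1 < κ) (hd : 0 < d) (hN : 0 < N)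
    (hL₀ : 0 < L₀) (h : 2 ^ 27 * c ^ (-(1 / (2 * κ - 1))) * L₀ ^ (2 * κ / (2 * κ - 1))
      * (d / N) ^ (κ / (2 * κ - 1)) ≤ 1) : L₀ ^ 2 ≤ c ^ (1 / κ) / d * N := by
  have h1 : (0 : ℝ) < 2 * κ - 1 := by linarith
  have h2 : (0 : ℝ) < κ := by linarith
  have hq : (c ^ (1 / κ)) ^ (κ / (2 * κ - 1)) = c ^ (1 / (2 * κ - 1)) := by
    rw [← Real.rpow_mul hc.le]
    congr 1
    field_simp
  have hp0 : 0 < κ / (2 * κ - 1) := by positivity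
  have e2p : L₀ ^ (2 * κ / (2 * κ - 1)) = (L₀ ^ 2) ^ (κ / (2 * κ - 1)) := by
    rw [← Real.rpow_natCast L₀ 2, ← Real.rpow_mul hL₀.le]
    congr 1
    push_cast
    ring
  have hcs := Real.rpow_pos_of_pos hc (1 / κ)
  by_contra! hlt
  have h3 : 1 < L₀ ^ 2 * (d / N) / c ^ (1 / κ) := by
    rw [one_lt_div hcs]
    calc c ^ (1 / κ) = c ^ (1 / κ) / d * N * (d / N) := by field_simp
      _ < L₀ ^ 2 * (d / N) := mul_lt_mul_of_pos_right hlt (by positivity)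
  have h4 := Real.one_lt_rpow h3 hp0
  rw [Real.div_rpow (by positivity) hcs.le, hq, Real.mul_rpow (by positivity) (by positivity),
    ← e2p] at h4
  rw [Real.rpow_neg hc.le] at h
  have h5 : 2 ^ 27 * (c ^ (1 / (2 * κ - 1)))⁻¹ * L₀ ^ (2 * κ / (2 * κ - 1))
      * (d / N) ^ (κ / (2 * κ - 1)) = 2 ^ 27 * (L₀ ^ (2 * κ / (2 * κ - 1))
      * (d / N) ^ (κ / (2 * κ - 1)) / c ^ (1 / (2 * κ - 1))) := by ring
  rw [h5] at h
  linarith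

/-- A bounded critical temperature forces `M ^ 2`, hence the confidence term, to grow with `N`. -/
theorem lt_sq_of_critTemp_lt {b : ℝ} (hc : 0 < c) (hκ : 1 < κ) (hd : 0 < d) (hM : 0 < M)
    (hN : 0 < N) (hb : critTemp c κ d M N < b) :
    N * (d * (c / d) ^ (1 / κ)) < 128 * b ^ (2 - 1 / κ) * M ^ 2 := by
  have h2 : (0 : ℝ) < κ := by linarith
  have hs : 1 / κ ≤ 1 := by rw [div_le_one h2]; exact hκ.le
  have h := Real.rpow_lt_rpow (critTemp_pos (κ := κ) hc hd hM hN).le hb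
    (show 0 < 2 - 1 / κ by linarith)
  rw [critTemp_rpow hc hκ hd hM hN, div_mul_eq_mul_div, div_lt_iff₀ (by positivity)] at h
  linarith

end Rates

/-- For large samples, the grid holds temperatures at which the empirical bound is nonpositive and
which achieve the announced rate, unless this rate is trivial. -/
theorem eventually_exists_temperatures {c κ d : ℝ} (hc : 0 < c) (hκ : 1 < κ) (hd : 0 < d) (b : ℝ) :
    ∀ᶠ N : ℕ in atTop, 0 < N ∧ 7 ≤ (grid 2 N).card ∧ ∀ ε : ℝ, 0 < ε → ε < 1 →
      0 ≤ Real.log (Real.log N / ε) ∧ ∀ L T : ℝ, L = Real.log (((grid 2 N).card : ℝ) ^ 2 / ε) →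
      T = 2 ^ 27 * c ^ (-(1 / (2 * κ - 1)))
        * (1 + 4 / d * Real.log (Real.log N / ε)) ^ (2 * κ / (2 * κ - 1))
        * (d / N) ^ (κ / (2 * κ - 1)) → T ≤ 1 →
      ∃ β ∈ grid 2 N, ∃ γ ∈ grid 2 N, b ≤ β ∧ 2 * d ≤ T * β ∧ 512 * β * (d + L) ≤ γ * d ∧
        ∀ D x : ℝ, 0 ≤ D → D ≤ 1 → 0 ≤ x → c * D ^ κ ≤ x →
          4 * (γ ^ 2 / N) * D ≤ (d + L + β * x) / 8 := by
  have hκ0 : 0 < κ := by linarith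
  have hs : 1 / κ < 1 := by rw [div_lt_one hκ0]; exact hκ
  set b₁ := max b 1 with hb₁
  have hb1 : 1 ≤ b₁ := le_max_right _ _
  set K₁ := (2048 * b₁) ^ 2 * (c ^ (1 / κ) / d) with hK₁
  set K₂ := d * (c / d) ^ (1 / κ) with hK₂
  have hK₂pos : 0 < K₂ := mul_pos hd (Real.rpow_pos_of_pos (div_pos hc hd) _)
  set K₃ := 512 * (1 + 32 * K₁ / d) with hK₃
  have hK₁pos : 0 < K₁ := mul_pos (by positivity) (div_pos (Real.rpow_pos_of_pos hc _) hd)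
  have hcast : Tendsto (fun N : ℕ => (N : ℝ)) atTop atTop := tendsto_natCast_atTop_atTop
  have hlog : Tendsto (fun N : ℕ => Real.log N) atTop atTop := Real.tendsto_log_atTop.comp hcast
  have h2 : 0 < Real.log 2 := Real.log_pos (by norm_num)
  have hhalf : (1 / 2 : ℝ) < Real.log 2 := by linarith [Real.log_two_gt_d9]
  filter_upwards [hcast.eventually_gt_atTop 0, hlog.eventually_ge_atTop 7,
    ((tendsto_rpow_atTop (show 0 < 1 - 1 / κ by linarith)).comp hcast).eventually_gt_atTop
      (d / 32 * (c / d) ^ (1 / κ)), hcast.eventually_gt_atTop K₁,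
    hcast.eventually_ge_atTop (128 * (2 * b₁) ^ (2 - 1 / κ) * K₃ ^ 2 / K₂)]
    with N hN hlog7 hH3 hH4 hH5
  have hlog2 : Real.log 2 ≤ 1 := by linarith [Real.log_two_lt_d9]
  have hcard7 : (7 : ℝ) ≤ ((grid 2 N).card : ℝ) := by
    rw [card_grid_two]
    refine le_trans ?_ (Nat.le_ceil _)
    rw [le_div_iff₀ h2]
    linarith
  have hcardle : ((grid 2 N).card : ℝ) ≤ Real.log N ^ 2 := by
    rw [card_grid_two]
    have h3 := (Nat.ceil_lt_add_one (div_nonneg (by linarith : 0 ≤ Real.log N) h2.le)).le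
    have h4 : Real.log N / Real.log 2 ≤ 2 * Real.log N := by
      rw [div_le_iff₀ h2]
      nlinarith
    nlinarith
  have hN0 : 0 < N := by exact_mod_cast hN
  refine ⟨hN0, by exact_mod_cast hcard7, fun ε hε hε1 => ?_⟩
  have hlogε : 1 ≤ Real.log N / ε := by
    rw [one_le_div hε]
    linarith
  have hΛ : 0 ≤ Real.log (Real.log N / ε) := Real.log_nonneg hlogε
  refine ⟨hΛ, fun L T hL hT hT1 => ?_⟩
  set n : ℝ := ((grid 2 N).card : ℝ) with hn
  -- The grid has at most `(log N) ^ 2` points and `ε ^ 4 ≤ ε`; this is the source of the constant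
  -- `B₈ = 4`.
  have hL4 : L ≤ 4 * Real.log (Real.log N / ε) := by
    have h3 : (4 : ℝ) * Real.log (Real.log N / ε) = Real.log ((Real.log N / ε) ^ 4) := by
      rw [Real.log_pow]; norm_num
    rw [hL, h3]
    refine Real.log_le_log (by positivity) ?_
    rw [div_pow]
    have h4 : n ^ 2 ≤ Real.log N ^ 4 := by
      calc n ^ 2 ≤ (Real.log N ^ 2) ^ 2 := pow_le_pow_left₀ (by linarith) hcardle 2
        _ = _ := by ring
    have h5 : ε ^ 4 ≤ ε := pow_le_of_le_one hε.le hε1.le (by norm_num)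
    exact div_le_div₀ (by positivity) h4 (by positivity) h5
  have hL0 : 0 ≤ L := by
    rw [hL]
    refine Real.log_nonneg ?_
    rw [one_le_div hε]
    nlinarith
  set L₀ := 1 + 4 / d * Real.log (Real.log N / ε) with hL₀
  have hL₀1 : 1 ≤ L₀ := by
    have := mul_nonneg (div_nonneg (by norm_num : (0 : ℝ) ≤ 4) hd.le) hΛ
    linarith
  set M := 512 * (1 + L / d) with hM
  have hLd : 0 ≤ L / d := div_nonneg hL0 hd.le
  have hM512 : 512 ≤ M := by linarith
  have hM0 : 0 < M := by linarith
  have hML : M ≤ 512 * L₀ := by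
    have : L / d ≤ 4 / d * Real.log (Real.log N / ε) := by
      rw [div_mul_eq_mul_div]
      exact div_le_div_of_nonneg_right hL4 hd.le
    linarith
  have hMd : M * d = 512 * (d + L) := by rw [hM]; field_simp
  have hcrit := critTemp_pos (κ := κ) hc hd hM0 hN
  have hrate := rate_mul_critTemp hc hκ hd hM0 hN hL₀1 hML
  rw [← hT] at hrate
  set βs := critTemp c κ d M N with hβs
  have hTpos : 0 < T := by
    refine pos_of_mul_pos_left (lt_of_lt_of_le ?_ hrate) hcrit.le
    linarith
  have hT1' : L₀ ^ 2 ≤ c ^ (1 / κ) / d * N :=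
    sq_le_of_rate_le_one hc hκ hd hN (by linarith) (hT ▸ hT1)
  clear_value βs
  -- Rounding down to a power of two loses at most a factor 2; starting from `2 * b₁` keeps `β`
  -- above `b₁`.
  obtain ⟨k, hk1, hk2⟩ := exists_two_pow_mem_Ioc (x := max βs (2 * b₁))
    (le_trans (by linarith) (le_max_right _ _))
  set β : ℝ := 2 ^ k with hβ
  have hβ0 : 0 < β := by positivity
  have hβb : b₁ < β := by linarith [le_max_right βs (2 * b₁)]
  have hββs : βs / 2 < β := by linarith [le_max_left βs (2 * b₁)]
  have hMβ : 512 ≤ M * β := by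
    calc (512 : ℝ) = 512 * 1 := (mul_one _).symm
      _ ≤ M * β := mul_le_mul hM512 (hb1.trans hβb.le) zero_le_one (by linarith)
  obtain ⟨j, hj1, hj2⟩ := exists_two_pow_mem_Ioc (x := 2 * (M * β)) (by linarith)
  set γ : ℝ := 2 ^ j with hγ
  have hγ0 : 0 < γ := by positivity
  have hγM : M * β < γ := by linarith
  have hβγ : β < γ := (le_mul_of_one_le_left hβ0.le (by linarith)).trans_lt hγM
  have main : 2 * (M * β) < N ∧ ∀ D x : ℝ, 0 ≤ D → D ≤ 1 → 0 ≤ x → c * D ^ κ ≤ x →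
      4 * (γ ^ 2 / N) * D ≤ (d + L + β * x) / 8 := by
    rcases le_or_gt (2 * b₁) βs with hcase | hcase
    · rw [max_eq_left hcase, hβs] at hk2
      refine ⟨lt_of_le_critTemp hc hκ hd (by linarith) hN hβ0 hk2 hH3,
        fun D x hD _ hx hDx => ?_⟩
      have := variance_le_of_le_critTemp hc hκ hd hM0 hN hβ0 hk2 hγ0.le hj2 hD hx hDx
      linarith
    -- When `ε` is so small that the critical temperature falls below `2 * b₁`, `β` stays of order
    -- `b₁`. Then `γ ^ 2 / N ≤ K₁`, and the variance is absorbed by `L` alone.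
    · rw [max_eq_right hcase.le] at hk2
      have h4 : (2 * (M * β)) ^ 2 ≤ K₁ * N := by
        have h5 : 2 * (M * β) ≤ 2048 * b₁ * L₀ := by
          calc 2 * (M * β) ≤ 2 * (512 * L₀ * (2 * b₁)) := by gcongr
            _ = _ := by ring
        calc (2 * (M * β)) ^ 2 ≤ (2048 * b₁ * L₀) ^ 2 :=
              pow_le_pow_left₀ (by positivity) h5 2
          _ = (2048 * b₁) ^ 2 * L₀ ^ 2 := by ring
          _ ≤ (2048 * b₁) ^ 2 * (c ^ (1 / κ) / d * N) :=
              mul_le_mul_of_nonneg_left hT1' (by positivity)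
          _ = _ := by rw [hK₁]; ring
      refine ⟨?_, fun D x hD hD1 hx _ => ?_⟩
      · refine lt_of_pow_lt_pow_left₀ 2 hN.le (h4.trans_lt ?_)
        rw [sq]
        exact mul_lt_mul_of_pos_right hH4 hN
      · have h6 : γ ^ 2 / N ≤ K₁ := by
          rw [div_le_iff₀ hN]
          exact (pow_le_pow_left₀ hγ0.le hj2 2).trans h4
        -- Otherwise `M` is at most the constant `K₃`, and for large `N` the critical temperature
        -- could not be below `2 * b₁`.
        have h7 : 32 * K₁ ≤ L := by
          by_contra! hlt
          have h8 := lt_sq_of_critTemp_lt hc hκ hd hM0 hN (hβs ▸ hcase)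
          rw [div_le_iff₀ hK₂pos] at hH5
          have h9 : M ≤ K₃ := by
            rw [hM, hK₃]
            have := div_le_div_of_nonneg_right hlt.le hd.le
            linarith
          have h10 : M ^ 2 ≤ K₃ ^ 2 := pow_le_pow_left₀ (by linarith) h9 2
          have h11 := mul_le_mul_of_nonneg_left h10
            (show 0 ≤ 128 * (2 * b₁) ^ (2 - 1 / κ) by positivity)
          linarith
        have h12 : 4 * (γ ^ 2 / N) * D ≤ 4 * K₁ * 1 := by gcongr
        have h13 := mul_nonneg hβ0.le hx
        linarith
  refine ⟨β, (mem_grid_two hN0).2 ⟨k, by linarith [main.1], rfl⟩, γ,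
    (mem_grid_two hN0).2 ⟨j, by linarith [main.1], rfl⟩, (le_max_left b 1).trans hβb.le, ?_, ?_,
    main.2⟩
  · have := mul_lt_mul_of_pos_left hββs hTpos
    linarith
  · calc 512 * β * (d + L) = M * β * d := by rw [mul_right_comm M, hMd]; ring
      _ ≤ γ * d := mul_le_mul_of_nonneg_right hγM.le hd.le

end GibbsMargin

/-! ### The oracle inequality. -/

theorem mainTheorem4 :
    ∃ B₇ B₈ : ℝ, 0 < B₇ ∧ 0 < B₈ ∧
      ∀ (X : Type u) [MeasurableSpace X]
        (Y : Type v) [Finite Y] [MeasurableSpace Y] [DiscreteMeasurableSpace Y]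
        (Θ : Type w) [MeasurableSpace Θ]
        (f : Θ → X → Y) (_ : Measurable (Function.uncurry f))
        (π : Measure Θ) [IsProbabilityMeasure π]
        (P : (N : ℕ) → Fin N → Measure (X × Y)) [∀ N i, IsProbabilityMeasure (P N i)]
        (R : Θ → ℝ) (_ : ∀ N : ℕ, 0 < N → ∀ θ, GibbsMargin.risk f (P N) θ = R θ)
        (c κ d : ℝ) (_ : 0 < c) (_ : 1 < κ) (_ : 0 < d)
        (θ₀ : Θ)
        (_ : ∀ N : ℕ, 0 < N → ∀ θ,
          c * GibbsMargin.disagreement f (P N) θ θ₀ ^ κ ≤ R θ - R θ₀)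
        (_ : Tendsto (fun β : ℝ => β * (∫ θ, R θ ∂(GibbsMargin.gibbs π R β) - ⨅ θ, R θ))
          atTop (𝓝 d)),
        ∃ N₁ : ℕ, ∀ N : ℕ, N₁ ≤ N → ∀ ε : ℝ, 0 < ε → ε < 1 →
          ∀ γhat : (Fin N → X × Y) → ℝ, (∀ z, γhat z ∈ GibbsMargin.gammaArgmax f π ε z) →
            Measure.pi (P N) {z | ¬ (∫ θ, R θ ∂(GibbsMargin.gibbs π (GibbsMargin.empRisk f z)
                (γhat z / 2)) ≤
              (⨅ θ, R θ) + B₇ * c ^ (-(1 / (2 * κ - 1)))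
                * (1 + B₈ / d * Real.log (Real.log N / ε)) ^ (2 * κ / (2 * κ - 1))
                * (d / N) ^ (κ / (2 * κ - 1)))} ≤ ENNReal.ofReal ε := by
  refine ⟨2 ^ 27, 4, by norm_num, by norm_num, ?_⟩
  intro X _ Y _ _ _ Θ _ f hf π _ P _ R hRisk c κ d hc hκ hd θ₀ hmargin hlim
  have hR0 : ∀ θ, 0 ≤ R θ - R θ₀ := fun θ => le_trans
    (mul_nonneg hc.le (Real.rpow_nonneg (GibbsMargin.disagreement_nonneg (P 1) θ θ₀) _))
    (hmargin 1 one_pos θ)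
  -- The margin assumption makes `θ₀` a minimizer of `R`.
  have hinf : ⨅ θ, R θ = R θ₀ := by
    have hmin : ∀ θ, R θ₀ ≤ R θ := fun θ => sub_nonneg.1 (hR0 θ)
    have : Nonempty Θ := ⟨θ₀⟩
    exact le_antisymm (ciInf_le ⟨R θ₀, by rintro _ ⟨θ, rfl⟩; exact hmin θ⟩ θ₀) (le_ciInf hmin)
  have hRm : GibbsMargin.BddMeas R := by
    rw [← funext (hRisk 1 one_pos)]
    exact GibbsMargin.bddMeas_risk hf (P 1)
  rw [hinf] at hlim ⊢
  have hmean : ∀ s, ∫ θ, (R θ - R θ₀) ∂(GibbsMargin.gibbs π (fun θ => R θ - R θ₀) s) =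
      ∫ θ, R θ ∂(GibbsMargin.gibbs π R s) - R θ₀ := by
    intro s
    have := hRm.gibbs s π
    rw [GibbsMargin.gibbs_sub_const, hRm.integral_sub (GibbsMargin.BddMeas.const _)]
    simp
  -- Beyond `b`, temperature times excess risk lies between `d / 2` and `2 * d`: the two dimension
  -- bounds used in localization.
  obtain ⟨b, hb⟩ := eventually_atTop.1
    (hlim.eventually (Icc_mem_nhds (by linarith : d / 2 < d) (by linarith : d < 2 * d)))
  obtain ⟨N₁, hN₁⟩ := eventually_atTop.1
    (GibbsMargin.eventually_exists_temperatures hc hκ hd b)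
  refine ⟨N₁, fun N hN ε hε hε1 γhat hγhat => ?_⟩
  obtain ⟨hN0, h7, hall⟩ := hN₁ N hN
  obtain ⟨hΛ, hall⟩ := hall ε hε hε1
  have hRN : GibbsMargin.risk f (P N) = R := funext (hRisk N hN0)
  have hrel : GibbsMargin.relRisk f (P N) θ₀ = fun θ => R θ - R θ₀ := by
    unfold GibbsMargin.relRisk
    rw [hRN]
  set T := 2 ^ 27 * c ^ (-(1 / (2 * κ - 1)))
    * (1 + 4 / d * Real.log (Real.log N / ε)) ^ (2 * κ / (2 * κ - 1))
    * (d / N) ^ (κ / (2 * κ - 1)) with hT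
  rcases le_or_gt T 1 with hT1 | hT1
  · obtain ⟨β, hβ, γ, hγ, hbβ, hTβ, hβγ, hvar⟩ := hall _ T rfl hT hT1
    have hβ0 : 0 < β := by
      obtain ⟨k, -, rfl⟩ := (GibbsMargin.mem_grid_two hN0).1 hβ
      positivity
    have hsel := GibbsMargin.measure_selection_le (P := P N) (π := π) hf hN0 h7 hε hε1 θ₀ rfl hβ hγ
      hd hβγ (by rw [hrel]; exact hR0)
      (fun s hs => by rw [hrel, hmean]; exact (hb s (hbβ.trans hs)).2)
      (fun s hs => by rw [hrel, hmean]; exact (hb s (hbβ.trans hs)).1)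
      (fun θ => by
        rw [hrel]
        exact hvar _ _ (GibbsMargin.disagreement_nonneg _ _ _)
          (GibbsMargin.disagreement_le_one _ _ _) (hR0 θ) (hmargin N hN0 θ)) hγhat
    refine (measure_mono ?_).trans hsel
    intro z hz hex
    refine hz ?_
    obtain ⟨β', -, hle, hmeanle⟩ := hex
    rw [hRN] at hmeanle
    have hβ'0 : 0 < β' := hβ0.trans_le hle
    have h1 := (hb β' (hbβ.trans hle)).2
    have h0 : 0 ≤ ∫ θ, R θ ∂(GibbsMargin.gibbs π R β') - R θ₀ := by
      rw [← hmean]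
      exact integral_nonneg hR0
    -- The `β'` of the selected pair is at least `β`, so `β` times the excess is at most `2 * d`,
    -- which is at most `T * β`.
    have h2 := mul_le_mul_of_nonneg_right hle h0
    have h3 : β * (∫ θ, R θ ∂(GibbsMargin.gibbs π R β') - R θ₀) ≤ β * T := by linarith
    have h4 := le_of_mul_le_mul_left h3 hβ0
    linarith
  -- When `T > 1` the bound is trivial because risks are at most 1, and the exceptional set is
  -- empty.
  · refine (measure_mono_null ?_ measure_empty).le.trans zero_le
    intro z hz
    refine hz ?_
    have := (GibbsMargin.bddMeas_empRisk hf z).gibbs (γhat z / 2) π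
    have h1 : ∫ θ, R θ ∂(GibbsMargin.gibbs π (GibbsMargin.empRisk f z) (γhat z / 2)) ≤ 1 := by
      simpa using integral_mono (hRm.integrable
        (GibbsMargin.gibbs π (GibbsMargin.empRisk f z) (γhat z / 2))) (integrable_const 1)
        fun θ => by rw [← hRisk 1 one_pos θ]; exact GibbsMargin.risk_le_one (P 1) θ
    have h2 : 0 ≤ R θ₀ := by rw [← hRisk 1 one_pos θ₀]; exact GibbsMargin.risk_nonneg (P 1) θ₀
    linarith
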